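/- For a lattice $\Lambda\subset\mathbb R^d$ (the $\mathbb Z$-span of a basis of $\mathbb R^d$), let $\mathbb T=\mathbb R^d/\Lambda$ be the flat torus with the metric induced by the Euclidean metric, and let $\Delta$ be its Laplace–Beltrami operator. Let $(e_j)_{j\ge 0}$ be a complete orthonormal system of $L^2(\mathbb T)$ (with respect to the Riemannian volume) consisting of smooth eigenfunctions, $-\Delta e_j=\lambda_j^2e_j$ with $0\le\lambda_0\le\lambda_1\le\cdots$. Such a system exists, and the local Weyl counting function $$N_{\mathbb T}(x,\lambda)=\sum_{\lambda_j\le\lambda}|e_j(x)|^2\qquad(x\in\mathbb T,\ \lambda\in\mathbb R)$$ does not depend on its choice. **Proposition.** For every integer $d\ge 4$ there exist two non-isometric flat tori $\mathbb T$ and $\mathbb T'$ of dimension $d$ whose local Weyl counting functions are identical everywhere: there is a function $f:\mathbb R\to[0,\infty)$ such that $$N_{\mathbb T}(x,\lambda)=N_{\mathbb T'}(y,\lambda)=f(\lambda)\qquad\text{for all }x\in\mathbb T,\ y\in\mathbb T',\ \lambda\in\mathbb R .$$ -/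

import Mathlib

open MeasureTheory
open scoped NNReal ENNReal ContDiff InnerProductSpace

/-- The flat torus `ℝᵈ / Λ`, where `Λ = ℤ b₁ + ⋯ + ℤ b_d` is the lattice spanned by the basis `b` of
Euclidean space `ℝᵈ`.  Mathlib equips this quotient of a normed group with the quotient topology and
with the distance `dist (v + Λ) (w + Λ) = inf {‖v - w + l‖ | l ∈ Λ}`, which is the Riemannian
distance of the flat metric that the Euclidean metric induces on the quotient. -/
abbrev FlatTorus {d : ℕ} (b : Module.Basis (Fin d) ℝ (EuclideanSpace ℝ (Fin d))) : Type :=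
  EuclideanSpace ℝ (Fin d) ⧸ (Submodule.span ℤ (Set.range b)).toAddSubgroup

namespace FlatTorus

variable {d : ℕ} (b : Module.Basis (Fin d) ℝ (EuclideanSpace ℝ (Fin d)))

/-- The projection `ℝᵈ → ℝᵈ / Λ`; it is the Riemannian universal covering. -/
def proj (v : EuclideanSpace ℝ (Fin d)) : FlatTorus b := QuotientAddGroup.mk v

/-- The Riemannian volume measure of the flat torus: the image under the projection of Lebesgue
measure on the half-open fundamental parallelepiped `{∑ tᵢ bᵢ | 0 ≤ tᵢ < 1}`. -/
noncomputable def vol : Measure (FlatTorus b) :=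
  Measure.map (proj b) (volume.restrict (ZSpan.fundamentalDomain b))

/-- Smoothness of a function on the torus. As the projection is a surjective local diffeomorphism,
this is smoothness of the lift to `ℝᵈ`. -/
def IsSmooth (f : FlatTorus b → ℂ) : Prop := ContDiff ℝ ∞ (f ∘ proj b)

/-- The Laplace-Beltrami operator `Δ` of the flat torus. As the projection is a local isometry, the
value at a point `x` is the Euclidean Laplacian of the lift at any point above `x`. -/
noncomputable def laplaceBeltrami (f : FlatTorus b → ℂ) (x : FlatTorus b) : ℂ :=
  Laplacian.laplacian (f ∘ proj b) (Quotient.out x)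

/-- The Laplace-Beltrami operator does not depend on the chosen lift of the point. -/
theorem laplaceBeltrami_proj (f : FlatTorus b → ℂ) (v : EuclideanSpace ℝ (Fin d)) :
    laplaceBeltrami b f (proj b v) = Laplacian.laplacian (f ∘ proj b) v := by
  obtain ⟨l, hl⟩ := QuotientAddGroup.mk_out_eq_add
    (Submodule.span ℤ (Set.range b)).toAddSubgroup v
  have hper : (fun w => (f ∘ proj b) (w + (l : EuclideanSpace ℝ (Fin d)))) = f ∘ proj b := by
    funext w
    simp only [Function.comp_apply, proj]
    congr 1
    exact QuotientAddGroup.mk_add_of_mem w l.2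
  unfold laplaceBeltrami
  change Laplacian.laplacian (f ∘ proj b) (Quotient.out (QuotientAddGroup.mk v)) = _
  rw [hl]
  simp only [InnerProductSpace.laplacian_eq_iteratedFDeriv_stdOrthonormalBasis]
  rw [← iteratedFDeriv_comp_add_right, hper]

/-- A complete orthonormal system of Laplace-Beltrami eigenfunctions of the flat torus,
`-Δ e_j = λ_j² e_j` with `0 ≤ λ_0 ≤ λ_1 ≤ ⋯`.  The eigenfunctions may be complex valued; a real
valued orthonormal eigenbasis is the special case in which all `e_j` are real. -/
structure EigenSystem where
  /-- The square roots `λ_j` of the eigenvalues, listed with multiplicity. -/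
  freq : ℕ → ℝ
  /-- The eigenfunctions `e_j`. -/
  e : ℕ → FlatTorus b → ℂ
  freq_nonneg : ∀ j, 0 ≤ freq j
  freq_mono : Monotone freq
  smooth : ∀ j, IsSmooth b (e j)
  eigen : ∀ j x, -laplaceBeltrami b (e j) x = ((freq j ^ 2 : ℝ) : ℂ) * e j x
  /-- The `e_j` form a Hilbert basis (complete orthonormal system) of `L²`. -/
  basis : HilbertBasis ℕ ℂ (Lp ℂ 2 (vol b))
  basis_ae : ∀ j, (basis j : FlatTorus b → ℂ) =ᵐ[vol b] e j

/-- The local Weyl counting function `N(x, t) = ∑_{λ_j ≤ t} |e_j(x)|²`, as a sum in `[0, ∞]`. -/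
noncomputable def localWeyl {b : Module.Basis (Fin d) ℝ (EuclideanSpace ℝ (Fin d))}
    (S : EigenSystem b) (x : FlatTorus b) (t : ℝ) : ℝ≥0∞ :=
  ∑' j : {j : ℕ // S.freq j ≤ t}, ‖S.e j x‖ₑ ^ 2

end FlatTorus

/-! Characters `exp(2πi⟨ξ, x⟩)`, with `ξ` in the dual lattice, have constant modulus and frequency
`2π‖ξ‖`, and they form an orthogonal basis of `L²`. Hence for every eigensystem and at every point,
the local counting function is the number of dual vectors with `2π‖ξ‖ ≤ t`, divided by the volume
(`localWeyl_eq`). What is needed is a pair of non-isometric lattices with equal covolume and equally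
many vectors of each length.

In dimension 4 these are the Conway-Sloane lattices, spanned by the rows of two integer matrices
that differ in the sign of the diagonal, with the form `x₀² + 2x₁² + 3x₂² + 4x₃²`. A nonlinear
bijection that changes at most one sign (`signFlip`) matches their vectors and keeps every squared
coordinate. They are not isometric, since the Gram matrix of two short vectors of one does not occur
in the other (`conwaySloaneNeg_not_represents`). For larger `d`, an orthogonal summand `√30 ℤᵏ` is
added; its vectors are too long to disturb this argument.

An isometry of tori lifts to an affine isometry of `ℝᵈ` (`exists_linearIsometryEquiv_lift`). Its
linear part maps one lattice into the other, so the inverse maps dual lattice into dual lattice. -/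

namespace FlatTorus

variable {d : ℕ} (b : Module.Basis (Fin d) ℝ (EuclideanSpace ℝ (Fin d)))

/-! ### The flat torus as a compact group with Haar measure -/

theorem continuous_proj : Continuous (proj b) := continuous_quotient_mk'

theorem proj_surjective : Function.Surjective (proj b) := QuotientAddGroup.mk_surjective

theorem proj_add (v w : EuclideanSpace ℝ (Fin d)) : proj b (v + w) = proj b v + proj b w := rfl

theorem proj_sub (v w : EuclideanSpace ℝ (Fin d)) : proj b (v - w) = proj b v - proj b w := rfl

theorem proj_eq_zero_iff {v : EuclideanSpace ℝ (Fin d)} :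
    proj b v = 0 ↔ v ∈ Submodule.span ℤ (Set.range b) :=
  QuotientAddGroup.eq_zero_iff v

/-- Gives the translation invariance of `vol`. Cosets are orbits of right translation, hence the
opposite group; commutativity reduces this to the usual fundamental domain. -/
theorem isAddFundamentalDomain_op :
    IsAddFundamentalDomain (Submodule.span ℤ (Set.range b)).toAddSubgroup.op
      (ZSpan.fundamentalDomain b) volume := by
  refine IsAddFundamentalDomain.mk' (ZSpan.fundamentalDomain_measurableSet b).nullMeasurableSet
    fun x => ?_
  obtain ⟨v, hv, hu⟩ := ZSpan.exist_unique_vadd_mem_fundamentalDomain b x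
  refine ⟨⟨AddOpposite.op v.1, v.2⟩, ?_, ?_⟩
  · change x + v.1 ∈ _
    rw [add_comm]
    exact hv
  · rintro ⟨w, hw⟩ h
    have h' : x + w.unop ∈ ZSpan.fundamentalDomain b := h
    have := hu ⟨w.unop, hw⟩ (by rw [add_comm] at h'; exact h')
    ext1
    simp [← this]

instance : IsFiniteMeasure (vol b) := by
  unfold vol
  have : IsFiniteMeasure (volume.restrict (ZSpan.fundamentalDomain b)) :=
    ⟨by simpa using (ZSpan.fundamentalDomain_isBounded b).measure_lt_top⟩
  infer_instance

instance : (vol b).IsAddLeftInvariant := by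
  have h := isAddFundamentalDomain_op b
  have : HasAddFundamentalDomain (Submodule.span ℤ (Set.range b)).toAddSubgroup.op
    (EuclideanSpace ℝ (Fin d)) volume := ⟨_, h⟩
  have : Countable (Submodule.span ℤ (Set.range b)).toAddSubgroup.op := by
    have : Countable (Submodule.span ℤ (Set.range b)) := inferInstance
    exact (AddSubgroup.equivOp
      (Submodule.span ℤ (Set.range b)).toAddSubgroup).symm.injective.countable
  have : AddQuotientMeasureEqMeasurePreimage volume (vol b) :=
    h.addQuotientMeasureEqMeasurePreimage (by rfl)
  exact MeasureTheory.AddQuotientMeasureEqMeasurePreimage.addInvariantMeasure_quotient volume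

instance : CompactSpace (FlatTorus b) := by
  rw [← isCompact_univ_iff, ← (proj_surjective b).range_eq]
  exact IsZLattice.isCompact_range_of_periodic (Submodule.span ℤ (Set.range b)) _ (continuous_proj b)
    fun z w hw => QuotientAddGroup.mk_add_of_mem z hw

theorem vol_univ : vol b Set.univ = volume (ZSpan.fundamentalDomain b) := by
  rw [vol, Measure.map_apply (continuous_proj b).measurable MeasurableSet.univ]
  simp

instance : NeZero (vol b) := by
  refine ⟨fun h => ?_⟩
  have := vol_univ b
  rw [h] at this
  exact ZSpan.measure_fundamentalDomain_ne_zero b this.symm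

instance : (vol b).IsOpenPosMeasure := isOpenPosMeasure_of_addLeftInvariant_of_regular

theorem vol_real_pos : 0 < (vol b).real Set.univ := by
  rw [measureReal_def]
  exact ENNReal.toReal_pos (NeZero.ne _) (measure_ne_top _ _)

/-! ### Characters -/

/-- The lift to `ℝᵈ` of the character of the torus with frequency `n`, in the coordinates given by
the lattice basis. -/
noncomputable def charLift (n : Fin d → ℤ) (v : EuclideanSpace ℝ (Fin d)) : ℂ :=
  Complex.exp (2 * Real.pi * Complex.I * (∑ i, (n i : ℝ) * b.repr v i : ℝ))

theorem continuous_charLift (n : Fin d → ℤ) : Continuous (charLift b n) := by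
  have : ∀ i, Continuous fun v => b.repr v i := fun i =>
    (b.coord i).continuous_of_finiteDimensional
  unfold charLift
  fun_prop

theorem charLift_add_mem (n : Fin d → ℤ) (v : EuclideanSpace ℝ (Fin d))
    {l : EuclideanSpace ℝ (Fin d)} (hl : l ∈ Submodule.span ℤ (Set.range b)) :
    charLift b n (v + l) = charLift b n v := by
  rw [b.mem_span_iff_repr_mem ℤ] at hl
  choose k hk using hl
  unfold charLift
  rw [Complex.exp_eq_exp_iff_exists_int]
  refine ⟨∑ i, n i * k i, ?_⟩
  simp only [map_add, Finsupp.add_apply, ← hk, mul_add, Finset.sum_add_distrib]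
  push_cast
  simp
  ring

/-- The characters of the flat torus. -/
noncomputable def char (n : Fin d → ℤ) : C(FlatTorus b, ℂ) where
  toFun := Quotient.lift (charLift b n) fun v w h => by
    have h' := QuotientAddGroup.leftRel_apply.1 h
    rw [← charLift_add_mem b n v h', add_neg_cancel_left]
  continuous_toFun := (continuous_charLift b n).quotient_lift _

theorem char_proj (n : Fin d → ℤ) (v : EuclideanSpace ℝ (Fin d)) :
    char b n (proj b v) = charLift b n v := rfl

theorem char_comp_proj (n : Fin d → ℤ) : char b n ∘ proj b = charLift b n := rfl

theorem norm_char (n : Fin d → ℤ) (x : FlatTorus b) : ‖char b n x‖ = 1 := by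
  obtain ⟨v, rfl⟩ := proj_surjective b x
  rw [char_proj, charLift, Complex.norm_exp]
  simp

theorem char_add_apply (n : Fin d → ℤ) (x y : FlatTorus b) :
    char b n (x + y) = char b n x * char b n y := by
  obtain ⟨v, rfl⟩ := proj_surjective b x
  obtain ⟨w, rfl⟩ := proj_surjective b y
  rw [← proj_add, char_proj, char_proj, char_proj, charLift, charLift, charLift, ← Complex.exp_add,
    ← mul_add, ← Complex.ofReal_add, ← Finset.sum_add_distrib]
  simp [mul_add]

theorem char_zero : char b 0 = 1 := by
  ext x
  obtain ⟨v, rfl⟩ := proj_surjective b x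
  simp [char_proj, charLift]

theorem char_add (m n : Fin d → ℤ) : char b (m + n) = char b m * char b n := by
  ext x
  obtain ⟨v, rfl⟩ := proj_surjective b x
  rw [ContinuousMap.mul_apply, char_proj, char_proj, char_proj, charLift, charLift, charLift,
    ← Complex.exp_add, ← mul_add, ← Complex.ofReal_add, ← Finset.sum_add_distrib]
  simp [add_mul]

theorem char_neg (n : Fin d → ℤ) : char b (-n) = star (char b n) := by
  ext x
  obtain ⟨v, rfl⟩ := proj_surjective b x
  rw [ContinuousMap.star_apply, char_proj, char_proj, charLift, charLift, Complex.star_def,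
    ← Complex.exp_conj]
  simp [Complex.conj_ofNat]

theorem charLift_single (i : Fin d) (v : EuclideanSpace ℝ (Fin d)) :
    charLift b (Pi.single i 1) v = Complex.exp (2 * Real.pi * Complex.I * (b.repr v i : ℝ)) := by
  rw [charLift, Finset.sum_eq_single i] <;> simp +contextual

/-- If all coordinate characters agree, the coordinates of the lifts differ by integers, so the
lifts differ by a lattice vector. -/
theorem exists_char_ne {x y : FlatTorus b} (h : x ≠ y) :
    ∃ i, char b (Pi.single i 1) x ≠ char b (Pi.single i 1) y := by
  obtain ⟨v, rfl⟩ := proj_surjective b x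
  obtain ⟨w, rfl⟩ := proj_surjective b y
  by_contra! hc
  apply h
  rw [← sub_eq_zero, ← proj_sub, proj_eq_zero_iff, b.mem_span_iff_repr_mem ℤ]
  intro i
  have := hc i
  rw [char_proj, char_proj, charLift_single, charLift_single,
    Complex.exp_eq_exp_iff_exists_int] at this
  obtain ⟨k, hk⟩ := this
  refine ⟨k, ?_⟩
  have h2 : (2 * Real.pi * Complex.I : ℂ) ≠ 0 := Complex.two_pi_I_ne_zero
  have : ((b.repr v i : ℝ) : ℂ) = (b.repr w i : ℝ) + k := by
    apply mul_left_cancel₀ h2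
    rw [hk]; ring
  have : b.repr v i = b.repr w i + k := by exact_mod_cast this
  simp [this]

/-- The star subalgebra of `C(FlatTorus b, ℂ)` generated by the characters. -/
noncomputable def charSubalgebra : StarSubalgebra ℂ C(FlatTorus b, ℂ) where
  toSubalgebra := Algebra.adjoin ℂ (Set.range (char b))
  star_mem' := by
    change Algebra.adjoin ℂ (Set.range (char b)) ≤ star (Algebra.adjoin ℂ (Set.range (char b)))
    refine Algebra.adjoin_le ?_
    rintro _ ⟨n, rfl⟩
    exact Algebra.subset_adjoin ⟨-n, char_neg b n⟩

theorem charSubalgebra_toSubmodule :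
    (charSubalgebra b).toSubalgebra.toSubmodule = Submodule.span ℂ (Set.range (char b)) := by
  apply Algebra.adjoin_eq_span_of_subset
  refine .trans (fun x ↦ Submonoid.closure_induction (fun _ ↦ id) ⟨0, char_zero b⟩ ?_)
    Submodule.subset_span
  rintro _ _ _ _ ⟨m, rfl⟩ ⟨n, rfl⟩
  exact ⟨m + n, char_add b m n⟩

theorem charSubalgebra_separatesPoints : (charSubalgebra b).SeparatesPoints := by
  intro x y hxy
  obtain ⟨i, hi⟩ := exists_char_ne b hxy
  exact ⟨_, ⟨char b (Pi.single i 1), Algebra.subset_adjoin ⟨_, rfl⟩, rfl⟩, hi⟩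

/-- Stone-Weierstrass: the span of the characters is a point-separating star algebra. -/
theorem span_char_closure_eq_top :
    (Submodule.span ℂ (Set.range (char b))).topologicalClosure = ⊤ := by
  rw [← charSubalgebra_toSubmodule]
  exact congr_arg (Subalgebra.toSubmodule <| StarSubalgebra.toSubalgebra ·)
    (ContinuousMap.starSubalgebra_topologicalClosure_eq_top_of_separatesPoints _
      (charSubalgebra_separatesPoints b))

/-! ### The Fourier basis of `L²` -/

/-- The class in `L²` of a continuous function on the torus. -/
noncomputable abbrev toL2 (f : C(FlatTorus b, ℂ)) : Lp ℂ 2 (vol b) :=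
  ContinuousMap.toLp 2 (vol b) ℂ f

theorem inner_toL2 (f g : C(FlatTorus b, ℂ)) :
    ⟪toL2 b f, toL2 b g⟫_ℂ = ∫ x, g x * (starRingEnd ℂ) (f x) ∂vol b :=
  ContinuousMap.inner_toLp (vol b) f g

theorem span_toL2_char_closure_eq_top :
    (Submodule.span ℂ (Set.range fun n => toL2 b (char b n))).topologicalClosure = ⊤ := by
  simpa only [Submodule.map_span, ContinuousLinearMap.coe_coe, ← Set.range_comp,
    Function.comp_def] using
    (ContinuousMap.toLp_denseRange ℂ (vol b) ℂ (by simp)).topologicalClosure_map_submodule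
      (span_char_closure_eq_top b)

theorem integral_char_eq_zero {n : Fin d → ℤ} (hn : n ≠ 0) : ∫ x, char b n x ∂vol b = 0 := by
  obtain ⟨i, hi⟩ := Function.ne_iff.1 hn
  have hi' : (n i : ℝ) ≠ 0 := by exact_mod_cast hi
  -- Translation by half a period of the character changes its sign but not its integral.
  set y := proj b ((1 / (2 * n i) : ℝ) • b i)
  have hy : char b n y = -1 := by
    rw [char_proj, charLift, Finset.sum_eq_single i]
    · have : (n i : ℝ) * b.repr ((1 / (2 * n i) : ℝ) • b i) i = 1 / 2 := by
        simp; field_simp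
      rw [this, ← Complex.exp_pi_mul_I]
      congr 1
      push_cast
      ring
    · intro j _ hj
      simp [hj.symm]
    · simp
  have h := integral_add_left_eq_self (μ := vol b) (fun x => char b n x) y
  simp_rw [char_add_apply, integral_const_mul, hy] at h
  have h2 : (2 : ℂ) * ∫ x, char b n x ∂vol b = 0 := by linear_combination -h
  simpa using h2

theorem inner_toL2_char (m n : Fin d → ℤ) :
    ⟪toL2 b (char b m), toL2 b (char b n)⟫_ℂ = if m = n then ((vol b).real Set.univ : ℂ) else 0 := by
  rw [inner_toL2]
  have : ∀ x, char b n x * (starRingEnd ℂ) (char b m x) = char b (n + -m) x := by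
    intro x
    rw [char_add, char_neg]
    rfl
  simp_rw [this]
  split_ifs with h
  · subst h
    simp [char_zero]
  · exact integral_char_eq_zero b fun h' => h (sub_eq_zero.1 ((sub_eq_add_neg n m).trans h')).symm

/-- The characters, normalized in `L²`. -/
noncomputable def normChar (n : Fin d → ℤ) : C(FlatTorus b, ℂ) :=
  ((Real.sqrt ((vol b).real Set.univ))⁻¹ : ℂ) • char b n

theorem normChar_apply (n : Fin d → ℤ) (x : FlatTorus b) :
    normChar b n x = ((Real.sqrt ((vol b).real Set.univ))⁻¹ : ℂ) * char b n x := rfl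

theorem orthonormal_normChar : Orthonormal ℂ fun n => toL2 b (normChar b n) := by
  rw [orthonormal_iff_ite]
  intro m n
  unfold normChar toL2
  rw [map_smul, map_smul, inner_smul_left, inner_smul_right, inner_toL2_char]
  split_ifs
  · have h := vol_real_pos b
    have h2 : ((Real.sqrt ((vol b).real Set.univ) : ℝ) : ℂ) ≠ 0 := by
      exact_mod_cast (Real.sqrt_pos.2 h).ne'
    have h3 : ((vol b).real Set.univ : ℂ) = (Real.sqrt ((vol b).real Set.univ) : ℂ) ^ 2 := by
      exact_mod_cast (Real.sq_sqrt h.le).symm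
    simp only [map_inv₀, Complex.conj_ofReal]
    rw [h3]
    field_simp
  · simp

theorem span_normChar_closure_eq_top :
    (Submodule.span ℂ (Set.range fun n => toL2 b (normChar b n))).topologicalClosure = ⊤ := by
  rw [← span_toL2_char_closure_eq_top b]
  congr 1
  have h2 : ((Real.sqrt ((vol b).real Set.univ))⁻¹ : ℂ) ≠ 0 := by
    exact_mod_cast inv_ne_zero (Real.sqrt_pos.2 (vol_real_pos b)).ne'
  apply le_antisymm <;> rw [Submodule.span_le] <;> rintro _ ⟨n, rfl⟩
  · change toL2 b (normChar b n) ∈ _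
    unfold normChar toL2
    rw [map_smul]
    exact Submodule.smul_mem _ _ (Submodule.subset_span ⟨n, rfl⟩)
  · change toL2 b (char b n) ∈ _
    have : toL2 b (char b n) =
        ((Real.sqrt ((vol b).real Set.univ))⁻¹ : ℂ)⁻¹ • toL2 b (normChar b n) := by
      unfold normChar toL2
      rw [map_smul, inv_smul_smul₀ h2]
    rw [this]
    exact Submodule.smul_mem _ _ (Submodule.subset_span ⟨n, rfl⟩)

/-- The Hilbert basis of `L²` of the torus consisting of the normalized characters. -/
noncomputable def fourierBasis : HilbertBasis (Fin d → ℤ) ℂ (Lp ℂ 2 (vol b)) :=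
  HilbertBasis.mk (orthonormal_normChar b) (span_normChar_closure_eq_top b).ge

theorem fourierBasis_apply (n : Fin d → ℤ) : fourierBasis b n = toL2 b (normChar b n) := by
  simp [fourierBasis]

theorem norm_normChar_sq (n : Fin d → ℤ) (x : FlatTorus b) :
    ‖normChar b n x‖ ^ 2 = ((vol b).real Set.univ)⁻¹ := by
  rw [normChar_apply, norm_mul, norm_char]
  simp [Real.sq_sqrt (vol_real_pos b).le, abs_of_nonneg (Real.sqrt_nonneg _)]

/-! ### Symmetry of the Laplace-Beltrami operator -/

theorem integral_vol (h : C(FlatTorus b, ℂ)) :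
    ∫ x, h x ∂vol b = ∫ v in ZSpan.fundamentalDomain b, h (proj b v) := by
  rw [vol, integral_map (continuous_proj b).measurable.aemeasurable
    h.continuous.aestronglyMeasurable]

theorem integrableOn_fundamentalDomain {H : EuclideanSpace ℝ (Fin d) → ℂ} (hH : Continuous H) :
    IntegrableOn H (ZSpan.fundamentalDomain b) := by
  have hb := ZSpan.fundamentalDomain_isBounded b
  exact (hH.continuousOn.integrableOn_compact hb.isCompact_closure).mono_set subset_closure

theorem exists_norm_le_of_periodic {F : Type*} [NormedAddCommGroup F]
    {H : EuclideanSpace ℝ (Fin d) → F} (hH : Continuous H)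
    (hper : ∀ v, ∀ l ∈ Submodule.span ℤ (Set.range b), H (v + l) = H v) : ∃ C, ∀ v, ‖H v‖ ≤ C := by
  have h := IsZLattice.isCompact_range_of_periodic (Submodule.span ℤ (Set.range b)) H hH
    fun v l hl => hper v l hl
  obtain ⟨C, hC⟩ := h.isBounded.exists_norm_le
  exact ⟨C, fun v => hC _ ⟨v, rfl⟩⟩

theorem fderiv_periodic {F : Type*} [NormedAddCommGroup F] [NormedSpace ℝ F]
    {H : EuclideanSpace ℝ (Fin d) → F}
    (hper : ∀ v, ∀ l ∈ Submodule.span ℤ (Set.range b), H (v + l) = H v) :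
    ∀ v, ∀ l ∈ Submodule.span ℤ (Set.range b), fderiv ℝ H (v + l) = fderiv ℝ H v := by
  intro v l hl
  have : (fun w => H (w + l)) = H := funext fun w => hper w l hl
  rw [← fderiv_comp_add_right, this]

/-- The integral of a directional derivative of a periodic function over a period vanishes. -/
theorem integral_fderiv_eq_zero {H : EuclideanSpace ℝ (Fin d) → ℂ} (hH : ContDiff ℝ 1 H)
    (hper : ∀ v, ∀ l ∈ Submodule.span ℤ (Set.range b), H (v + l) = H v)
    (w : EuclideanSpace ℝ (Fin d)) :
    ∫ v in ZSpan.fundamentalDomain b, fderiv ℝ H v w = 0 := by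
  let h : C(FlatTorus b, ℂ) :=
    { toFun := Quotient.lift H fun v w h => by
        have h' := QuotientAddGroup.leftRel_apply.1 h
        rw [← hper v _ h', add_neg_cancel_left]
      continuous_toFun := hH.continuous.quotient_lift _ }
  -- By invariance the integral of the translate does not depend on `s`; differentiating under the
  -- integral sign at `s = 0` gives the claim.
  have hconst : ∀ s : ℝ, ∫ v in ZSpan.fundamentalDomain b, H (v + s • w) =
      ∫ x, h x ∂vol b := by
    intro s
    rw [← integral_add_right_eq_self (μ := vol b) (fun x => h x) (proj b (s • w))]
    exact (integral_vol b (h.comp ⟨fun x => x + proj b (s • w), by fun_prop⟩)).symm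
  obtain ⟨C, hC⟩ := exists_norm_le_of_periodic b (hH.continuous_fderiv one_ne_zero)
    (fderiv_periodic b hper)
  have key := hasDerivAt_integral_of_dominated_loc_of_deriv_le
    (μ := volume.restrict (ZSpan.fundamentalDomain b)) (F := fun (s : ℝ) v => H (v + s • w))
    (F' := fun (s : ℝ) v => fderiv ℝ H (v + s • w) w) (x₀ := (0 : ℝ)) (s := Set.univ)
    (bound := fun _ => C * ‖w‖) Filter.univ_mem
    (.of_forall fun s => (hH.continuous.comp (by fun_prop)).aestronglyMeasurable)
    (integrableOn_fundamentalDomain b (hH.continuous.comp (by fun_prop)))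
    (by
      have := hH.continuous_fderiv one_ne_zero
      exact Continuous.aestronglyMeasurable (by fun_prop))
    (.of_forall fun v s _ => (ContinuousLinearMap.le_opNorm _ _).trans
      (mul_le_mul_of_nonneg_right (hC _) (norm_nonneg _)))
    (integrableOn_const (by simpa using (ZSpan.fundamentalDomain_isBounded b).measure_lt_top.ne))
    (.of_forall fun v s _ => by
      have h1 : HasDerivAt (fun s : ℝ => v + s • w) w s := by
        simpa using ((hasDerivAt_id s).smul_const w).const_add v
      exact ((hH.differentiable one_ne_zero) _).hasFDerivAt.comp_hasDerivAt s h1)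
  have h0 := key.2
  simp_rw [hconst] at h0
  simpa using h0.unique (hasDerivAt_const _ _)

theorem comp_proj_periodic (f : FlatTorus b → ℂ) (v : EuclideanSpace ℝ (Fin d))
    {l : EuclideanSpace ℝ (Fin d)} (hl : l ∈ Submodule.span ℤ (Set.range b)) :
    (f ∘ proj b) (v + l) = (f ∘ proj b) v :=
  congrArg f (QuotientAddGroup.mk_add_of_mem v hl)

theorem laplacian_eq_sum_fderiv (F : EuclideanSpace ℝ (Fin d) → ℂ)
    (v : EuclideanSpace ℝ (Fin d)) :
    Laplacian.laplacian F v = ∑ i, fderiv ℝ (fderiv ℝ F) v (stdOrthonormalBasis ℝ _ i)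
      (stdOrthonormalBasis ℝ _ i) := by
  rw [InnerProductSpace.laplacian_eq_iteratedFDeriv_stdOrthonormalBasis]
  simp [iteratedFDeriv_two_apply]

/-- Green's identity on a flat torus, for the lifts. -/
theorem integral_laplacian_mul_sub {f g : FlatTorus b → ℂ} (hf : IsSmooth b f)
    (hg : IsSmooth b g) :
    ∫ v in ZSpan.fundamentalDomain b, (Laplacian.laplacian (f ∘ proj b) v * (g ∘ proj b) v -
      (f ∘ proj b) v * Laplacian.laplacian (g ∘ proj b) v) = 0 := by
  set F := f ∘ proj b with hF
  set G := g ∘ proj b with hG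
  have hf : ContDiff ℝ ∞ F := hf
  have hg : ContDiff ℝ ∞ G := hg
  have hf' : ContDiff ℝ 1 (fderiv ℝ F) := hf.fderiv_right (by norm_cast)
  have hg' : ContDiff ℝ 1 (fderiv ℝ G) := hg.fderiv_right (by norm_cast)
  have hf1 : ContDiff ℝ 1 F := hf.of_le (by norm_cast)
  have hg1 : ContDiff ℝ 1 G := hg.of_le (by norm_cast)
  have pF : ∀ v, ∀ l ∈ Submodule.span ℤ (Set.range b), F (v + l) = F v :=
    fun v l hl => comp_proj_periodic b f v hl
  have pG : ∀ v, ∀ l ∈ Submodule.span ℤ (Set.range b), G (v + l) = G v :=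
    fun v l hl => comp_proj_periodic b g v hl
  let u := stdOrthonormalBasis ℝ (EuclideanSpace ℝ (Fin d))
  -- The components of `G ∇F - F ∇G`, whose divergence is the integrand.
  let H : _ → EuclideanSpace ℝ (Fin d) → ℂ :=
    fun i v => fderiv ℝ F v (u i) * G v - F v * fderiv ℝ G v (u i)
  have hH : ∀ i, ContDiff ℝ 1 (H i) := fun i => by fun_prop
  have pH : ∀ i v, ∀ l ∈ Submodule.span ℤ (Set.range b), H i (v + l) = H i v := by
    intro i v l hl
    simp only [H, pF v l hl, pG v l hl, fderiv_periodic b pF v l hl, fderiv_periodic b pG v l hl]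
  have hd : ∀ i v, fderiv ℝ (H i) v (u i) = fderiv ℝ (fderiv ℝ F) v (u i) (u i) * G v -
      F v * fderiv ℝ (fderiv ℝ G) v (u i) (u i) := by
    intro i v
    have e1 := ((hf'.differentiable one_ne_zero v).hasFDerivAt.clm_apply
      (hasFDerivAt_const (u i) v)).mul (hg1.differentiable one_ne_zero v).hasFDerivAt
    have e2 := (hf1.differentiable one_ne_zero v).hasFDerivAt.mul
      ((hg'.differentiable one_ne_zero v).hasFDerivAt.clm_apply (hasFDerivAt_const (u i) v))
    have e3 : HasFDerivAt (H i) _ v := e1.sub e2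
    rw [e3.fderiv]
    simp
    ring
  have hsum : ∀ v, Laplacian.laplacian F v * G v - F v * Laplacian.laplacian G v =
      ∑ i, fderiv ℝ (H i) v (u i) := by
    intro v
    simp_rw [hd, laplacian_eq_sum_fderiv, Finset.sum_sub_distrib, Finset.sum_mul, Finset.mul_sum]
    rfl
  simp_rw [hsum]
  rw [integral_finsetSum]
  · exact Finset.sum_eq_zero fun i _ => integral_fderiv_eq_zero b (hH i) (pH i) (u i)
  · intro i _
    have := (hH i).continuous_fderiv one_ne_zero
    exact integrableOn_fundamentalDomain b (by fun_prop)

/-- Eigenfunctions for distinct eigenvalues are orthogonal. -/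
theorem integral_mul_eq_zero_of_eigen {f g : C(FlatTorus b, ℂ)} (hf : IsSmooth b f)
    (hg : IsSmooth b g) {μ ν : ℂ} (hμν : μ ≠ ν)
    (hμ : ∀ v, Laplacian.laplacian (f ∘ proj b) v = μ * f (proj b v))
    (hν : ∀ v, Laplacian.laplacian (g ∘ proj b) v = ν * g (proj b v)) :
    ∫ x, f x * g x ∂vol b = 0 := by
  have h := integral_laplacian_mul_sub b hf hg
  have e : ∀ v, (Laplacian.laplacian (f ∘ proj b) v * (g ∘ proj b) v -
      (f ∘ proj b) v * Laplacian.laplacian (g ∘ proj b) v) =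
      (μ - ν) * (f (proj b v) * g (proj b v)) := by
    intro v
    rw [hμ, hν]
    simp only [Function.comp_apply]
    ring
  simp_rw [e, integral_const_mul] at h
  have h' := (mul_eq_zero.1 h).resolve_left (sub_ne_zero.2 hμν)
  exact (integral_vol b (f * g)).trans h'

/-! ### Characters are eigenfunctions -/

/-- The vector of the dual lattice with coordinates `n` in the family `c`. -/
noncomputable def latticeVector (c : Fin d → EuclideanSpace ℝ (Fin d)) (n : Fin d → ℤ) :
    EuclideanSpace ℝ (Fin d) := ∑ i, (n i : ℝ) • c i

/-- The family `c` is dual to the basis `b`. -/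
def IsDual (c : Fin d → EuclideanSpace ℝ (Fin d)) : Prop :=
  ∀ i j, ⟪c i, b j⟫_ℝ = if i = j then 1 else 0

variable {b} {c : Fin d → EuclideanSpace ℝ (Fin d)}

theorem IsDual.inner_eq_repr (hc : IsDual b c) (i : Fin d) (v : EuclideanSpace ℝ (Fin d)) :
    ⟪c i, v⟫_ℝ = b.repr v i := by
  conv_lhs => rw [← b.sum_repr v, inner_sum]
  simp_rw [inner_smul_right, hc i]
  simp

theorem IsDual.inner_latticeVector (hc : IsDual b c) (n : Fin d → ℤ)
    (v : EuclideanSpace ℝ (Fin d)) :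
    ⟪latticeVector c n, v⟫_ℝ = ∑ i, (n i : ℝ) * b.repr v i := by
  simp [latticeVector, sum_inner, inner_smul_left, hc.inner_eq_repr]

theorem IsDual.charLift_eq (hc : IsDual b c) (n : Fin d → ℤ) :
    charLift b n = fun v =>
      Complex.exp (2 * Real.pi * Complex.I * (⟪latticeVector c n, v⟫_ℝ : ℝ)) := by
  ext v
  rw [charLift, hc.inner_latticeVector]

theorem IsDual.hasFDerivAt_charLift (hc : IsDual b c) (n : Fin d → ℤ)
    (v : EuclideanSpace ℝ (Fin d)) :
    HasFDerivAt (charLift b n) (charLift b n v • (2 * Real.pi * Complex.I : ℂ) •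
      (Complex.ofRealCLM.comp (innerSL ℝ (latticeVector c n)))) v := by
  rw [hc.charLift_eq]
  have h : HasFDerivAt (fun v => ((⟪latticeVector c n, v⟫_ℝ : ℝ) : ℂ))
      (Complex.ofRealCLM.comp (innerSL ℝ (latticeVector c n))) v :=
    (Complex.ofRealCLM.comp (innerSL ℝ (latticeVector c n))).hasFDerivAt
  exact (h.const_mul _).cexp

theorem IsDual.contDiff_charLift (hc : IsDual b c) (n : Fin d → ℤ) :
    ContDiff ℝ ∞ (charLift b n) := by
  rw [hc.charLift_eq]
  have h : ContDiff ℝ ∞ (fun v => ((⟪latticeVector c n, v⟫_ℝ : ℝ) : ℂ)) :=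
    (Complex.ofRealCLM.comp (innerSL ℝ (latticeVector c n))).contDiff
  exact (contDiff_const.mul h).cexp

theorem IsDual.isSmooth_char (hc : IsDual b c) (n : Fin d → ℤ) : IsSmooth b (char b n) :=
  hc.contDiff_charLift n

theorem IsDual.laplacian_charLift (hc : IsDual b c) (n : Fin d → ℤ)
    (v : EuclideanSpace ℝ (Fin d)) :
    Laplacian.laplacian (charLift b n) v =
      -(((2 * Real.pi * ‖latticeVector c n‖) ^ 2 : ℝ) : ℂ) * charLift b n v := by
  rw [laplacian_eq_sum_fderiv]
  have h1 : fderiv ℝ (charLift b n) = fun v => charLift b n v • (2 * Real.pi * Complex.I : ℂ) •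
      (Complex.ofRealCLM.comp (innerSL ℝ (latticeVector c n))) :=
    funext fun v => (hc.hasFDerivAt_charLift n v).fderiv
  have h2 : ∀ w, fderiv ℝ (fderiv ℝ (charLift b n)) v w w =
      -(2 * Real.pi) ^ 2 * (⟪latticeVector c n, w⟫_ℝ : ℝ) ^ 2 * charLift b n v := by
    intro w
    have h3 := (hc.hasFDerivAt_charLift n v).smul_const
      ((2 * Real.pi * Complex.I : ℂ) • (Complex.ofRealCLM.comp (innerSL ℝ (latticeVector c n))))
    rw [h1, h3.fderiv]
    simp
    linear_combination (charLift b n v * (2 * Real.pi) ^ 2 *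
      ((⟪latticeVector c n, w⟫_ℝ : ℝ) : ℂ) ^ 2) * Complex.I_sq
  simp_rw [h2]
  have h3 := (stdOrthonormalBasis ℝ (EuclideanSpace ℝ (Fin d))).sum_sq_norm_inner_left
    (latticeVector c n)
  rw [mul_pow _ ‖_‖, ← h3]
  push_cast
  rw [Finset.mul_sum, ← Finset.sum_neg_distrib, Finset.sum_mul]
  refine Finset.sum_congr rfl fun i _ => ?_
  rw [← Complex.ofReal_pow ‖_‖, Real.norm_eq_abs, sq_abs]
  push_cast
  ring

theorem latticeVector_neg (n : Fin d → ℤ) : latticeVector c (-n) = -latticeVector c n := by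
  simp [latticeVector]

end FlatTorus

/-! ### Enumeration in increasing order -/

theorem exists_equiv_nat_monotone {α : Type*} [Countable α] [Infinite α] (f : α → ℝ)
    (hfin : ∀ t, {a | f a ≤ t}.Finite) : ∃ σ : ℕ ≃ α, Monotone (f ∘ σ) := by
  obtain ⟨enc, henc⟩ := exists_injective_nat α
  -- The predecessors of `a`, with ties in `f` broken by `enc`. Their number is an injective rank,
  -- whose infinite range in `ℕ` is then listed in order.
  let s : α → Set α := fun a => {x | f x < f a ∨ f x = f a ∧ enc x < enc a}
  have hs : ∀ a, (s a).Finite := fun a => (hfin (f a)).subset fun x hx => by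
    rcases hx with h | h
    · exact h.le
    · exact h.1.le
  let r : α → ℕ := fun a => (s a).ncard
  have hlt : ∀ a a', (f a < f a' ∨ f a = f a' ∧ enc a < enc a') → r a < r a' := by
    intro a a' h
    refine Set.ncard_lt_ncard ⟨fun x hx => ?_, fun hsub => ?_⟩ (hs a')
    · simp only [s, Set.mem_ofPred_eq] at hx ⊢
      grind
    · have : a ∈ s a := hsub h
      simp [s] at this
  have hinj : Function.Injective r := by
    intro a a' h
    by_contra hne
    have he : enc a ≠ enc a' := fun h => hne (henc h)
    have h1 := hlt a a'
    have h2 := hlt a' a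
    grind
  have : Infinite (Set.range r) := (Equiv.ofInjective r hinj).infinite_iff.1 inferInstance
  classical
  let o := Nat.Subtype.orderIsoOfNat (Set.range r)
  refine ⟨o.toEquiv.trans (Equiv.ofInjective r hinj).symm, fun i j hij => ?_⟩
  by_contra! hc
  have h1 := hlt _ _ (Or.inl hc)
  have hr : ∀ y, r ((Equiv.ofInjective r hinj).symm y) = y :=
    fun y => congrArg Subtype.val ((Equiv.ofInjective r hinj).apply_symm_apply y)
  simp only [Equiv.trans_apply, hr] at h1
  exact absurd (o.monotone hij) (not_le.2 h1)

namespace FlatTorus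

variable {d : ℕ} {b : Module.Basis (Fin d) ℝ (EuclideanSpace ℝ (Fin d))}
  {c : Fin d → EuclideanSpace ℝ (Fin d)}

/-! ### The local Weyl counting function -/

/-- Pairing with `b i` recovers the coordinate `n i`, which Cauchy-Schwarz bounds. -/
theorem IsDual.finite_norm_le (hc : IsDual b c) (t : ℝ) :
    {n : Fin d → ℤ | 2 * Real.pi * ‖latticeVector c n‖ ≤ t}.Finite := by
  obtain ⟨N, hN⟩ := exists_nat_ge (∑ i, t / (2 * Real.pi) * ‖b i‖)
  refine (Set.finite_Icc (fun _ => -(N : ℤ)) (fun _ => (N : ℤ))).subset fun n hn => ?_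
  have hn : 2 * Real.pi * ‖latticeVector c n‖ ≤ t := hn
  have hpi := Real.two_pi_pos
  have ht : ‖latticeVector c n‖ ≤ t / (2 * Real.pi) := by
    rw [le_div_iff₀ hpi]; linarith
  have ht0 : 0 ≤ t / (2 * Real.pi) := (norm_nonneg _).trans ht
  have key : ∀ i, |(n i : ℝ)| ≤ N := by
    intro i
    have h1 : ⟪latticeVector c n, b i⟫_ℝ = n i := by
      rw [hc.inner_latticeVector]
      simp [Finsupp.single_apply]
    rw [← h1]
    calc |⟪latticeVector c n, b i⟫_ℝ| ≤ ‖latticeVector c n‖ * ‖b i‖ := abs_real_inner_le_norm _ _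
      _ ≤ t / (2 * Real.pi) * ‖b i‖ := by gcongr
      _ ≤ ∑ i, t / (2 * Real.pi) * ‖b i‖ :=
        Finset.single_le_sum (f := fun i => t / (2 * Real.pi) * ‖b i‖)
          (fun i _ => by positivity) (Finset.mem_univ i)
      _ ≤ N := hN
  refine ⟨fun i => ?_, fun i => ?_⟩ <;> have := abs_le.1 (key i)
  · exact_mod_cast this.1
  · exact_mod_cast this.2

/-- The eigenfunctions of an eigensystem as continuous functions. -/
noncomputable def EigenSystem.toContinuousMap (S : EigenSystem b) (j : ℕ) :
    C(FlatTorus b, ℂ) where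
  toFun := S.e j
  continuous_toFun :=
    isQuotientMap_quotient_mk'.continuous_iff.2 (S.smooth j).continuous

theorem EigenSystem.basis_eq (S : EigenSystem b) (j : ℕ) :
    S.basis j = toL2 b (S.toContinuousMap j) := by
  apply Lp.ext
  exact (S.basis_ae j).trans (ContinuousMap.coeFn_toLp (𝕜 := ℂ) (vol b) (S.toContinuousMap j)).symm

theorem EigenSystem.inner_fourierBasis_eq_zero (S : EigenSystem b) (hc : IsDual b c) (j : ℕ)
    {n : Fin d → ℤ} (hn : 2 * Real.pi * ‖latticeVector c n‖ ≠ S.freq j) :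
    ⟪fourierBasis b n, S.basis j⟫_ℂ = 0 := by
  rw [fourierBasis_apply, S.basis_eq]
  unfold normChar toL2
  rw [map_smul, inner_smul_left, inner_toL2]
  -- The conjugate is again a character with the same eigenvalue, so the bilinear orthogonality
  -- relation applies.
  have h : ∀ x, (starRingEnd ℂ) (char b n x) = char b (-n) x := fun x => by
    rw [char_neg]; rfl
  simp_rw [h]
  rw [integral_mul_eq_zero_of_eigen b (S.smooth j) (hc.isSmooth_char (-n))
    (μ := -((S.freq j ^ 2 : ℝ) : ℂ)) (ν := -(((2 * Real.pi * ‖latticeVector c n‖) ^ 2 : ℝ) : ℂ)),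
    mul_zero]
  · intro h
    apply hn
    have h : S.freq j ^ 2 = (2 * Real.pi * ‖latticeVector c n‖) ^ 2 := by
      exact_mod_cast neg_injective h
    exact ((sq_eq_sq₀ (S.freq_nonneg j) (by positivity)).1 h).symm
  · intro v
    have := S.eigen j (proj b v)
    rw [laplaceBeltrami_proj] at this
    change Laplacian.laplacian (S.e j ∘ proj b) v = _ * S.e j (proj b v)
    linear_combination -this
  · intro v
    rw [char_comp_proj, hc.laplacian_charLift, latticeVector_neg, norm_neg, char_proj]

/-- Only characters of frequency `S.freq j` contribute to the Fourier expansion, so it is finite.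
Both sides are continuous and `vol` charges open sets, so equality in `L²` is pointwise. -/
theorem EigenSystem.apply_eq_sum (S : EigenSystem b) (hc : IsDual b c) (j : ℕ)
    (s : Finset (Fin d → ℤ))
    (hs : ∀ n, 2 * Real.pi * ‖latticeVector c n‖ = S.freq j → n ∈ s) (x : FlatTorus b) :
    S.e j x = ∑ n ∈ s, ⟪fourierBasis b n, S.basis j⟫_ℂ * normChar b n x := by
  have h1 : S.basis j = ∑ n ∈ s, ⟪fourierBasis b n, S.basis j⟫_ℂ • fourierBasis b n := by
    have h := (fourierBasis b).hasSum_repr (S.basis j)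
    refine h.unique ?_
    simp_rw [HilbertBasis.repr_apply_apply]
    refine hasSum_sum_of_ne_finset_zero fun n hn => ?_
    rw [S.inner_fourierBasis_eq_zero hc j fun h => hn (hs n h), zero_smul]
  have h2 : toL2 b (S.toContinuousMap j) =
      toL2 b (∑ n ∈ s, ⟪fourierBasis b n, S.basis j⟫_ℂ • normChar b n) := by
    rw [← S.basis_eq]
    conv_lhs => rw [h1]
    simp only [toL2, map_sum, map_smul, fourierBasis_apply]
  have h3 := ContinuousMap.toLp_injective (p := 2) (𝕜 := ℂ) (vol b) h2
  have h4 := congrArg (fun f : C(FlatTorus b, ℂ) => f x) h3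
  simpa [EigenSystem.toContinuousMap] using h4

/-- `K` is the kernel at `x` of the spectral projection to frequencies at most `t`: pairing with it
evaluates `e_j` at `x` if `λ_j ≤ t` and gives `0` otherwise. Parseval in the given eigenbasis turns
`‖K‖²` into the counting function; in the Fourier basis, `‖K‖²` is a count of characters over the
volume. -/
theorem localWeyl_eq (hc : IsDual b c) (S : EigenSystem b) (x : FlatTorus b) (t : ℝ) :
    localWeyl S x t = ENNReal.ofReal
      ({n : Fin d → ℤ | 2 * Real.pi * ‖latticeVector c n‖ ≤ t}.ncard *
        ((vol b).real Set.univ)⁻¹) := by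
  classical
  have hfin := hc.finite_norm_le t
  let s := hfin.toFinset
  let K : Lp ℂ 2 (vol b) := ∑ n ∈ s, (starRingEnd ℂ) (normChar b n x) • fourierBasis b n
  have hK : ‖K‖ ^ 2 = s.card * ((vol b).real Set.univ)⁻¹ := by
    have h := (fourierBasis b).orthonormal.inner_sum (fun n => (starRingEnd ℂ) (normChar b n x))
      (fun n => (starRingEnd ℂ) (normChar b n x)) s
    have h' : ∀ n, (starRingEnd ℂ) ((starRingEnd ℂ) (normChar b n x)) *
        (starRingEnd ℂ) (normChar b n x) = ((((vol b).real Set.univ)⁻¹ : ℝ) : ℂ) := by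
      intro n
      rw [← norm_normChar_sq b n x, Complex.conj_conj, Complex.mul_conj']
      push_cast
      rfl
    simp_rw [h'] at h
    have h2 : ⟪K, K⟫_ℂ = _ := h
    have h3 : ⟪K, K⟫_ℂ = (‖K‖ : ℂ) ^ 2 := inner_self_eq_norm_sq_to_K K
    rw [h3] at h2
    simp only [Finset.sum_const, nsmul_eq_mul] at h2
    exact_mod_cast h2
  have hinner : ∀ j, ⟪K, S.basis j⟫_ℂ = if S.freq j ≤ t then S.e j x else 0 := by
    intro j
    have h1 : ⟪K, S.basis j⟫_ℂ =
        ∑ n ∈ s, ⟪fourierBasis b n, S.basis j⟫_ℂ * normChar b n x := by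
      simp only [K, sum_inner, inner_smul_left, Complex.conj_conj]
      exact Finset.sum_congr rfl fun n _ => mul_comm _ _
    rw [h1]
    split_ifs with hj
    · exact (S.apply_eq_sum hc j s (fun n hn => by simp [s, hn, hj]) x).symm
    · refine Finset.sum_eq_zero fun n hn => ?_
      rw [S.inner_fourierBasis_eq_zero hc j, zero_mul]
      intro h
      apply hj
      rw [← h]
      simpa [s] using hn
  have hsum : HasSum (fun j => ‖⟪K, S.basis j⟫_ℂ‖ ^ 2) (‖K‖ ^ 2) := by
    have h := S.basis.hasSum_inner_mul_inner K K
    have h' : ∀ j, ⟪K, S.basis j⟫_ℂ * ⟪S.basis j, K⟫_ℂ = ((‖⟪K, S.basis j⟫_ℂ‖ ^ 2 : ℝ) : ℂ) := by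
      intro j
      rw [← inner_conj_symm (S.basis j) K, Complex.mul_conj']
      push_cast
      rfl
    simp_rw [h'] at h
    have h3 : ⟪K, K⟫_ℂ = (‖K‖ : ℂ) ^ 2 := inner_self_eq_norm_sq_to_K K
    rw [h3] at h
    exact_mod_cast h
  rw [Set.ncard_eq_toFinset_card _ hfin, ← hK, ← hsum.tsum_eq,
    ENNReal.ofReal_tsum_of_nonneg (fun j => by positivity) hsum.summable]
  refine (tsum_subtype {j | S.freq j ≤ t} (fun j => ‖S.e j x‖ₑ ^ 2)).trans ?_
  refine tsum_congr fun j => ?_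
  rw [hinner, Set.indicator_apply]
  simp only [Set.mem_ofPred_eq]
  split_ifs
  · rw [ENNReal.ofReal_pow (norm_nonneg _), ofReal_norm]
  · simp

/-- The flat torus has a complete orthonormal system of eigenfunctions. -/
theorem IsDual.nonempty_eigenSystem (hc : IsDual b c) (hd : 0 < d) :
    Nonempty (EigenSystem b) := by
  have : NeZero d := ⟨hd.ne'⟩
  have : Infinite (Fin d → ℤ) := inferInstance
  obtain ⟨σ, hσ⟩ := exists_equiv_nat_monotone
    (fun n : Fin d → ℤ => 2 * Real.pi * ‖latticeVector c n‖) hc.finite_norm_le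
  have hspan : (Submodule.span ℂ (Set.range (fourierBasis b ∘ σ))).topologicalClosure = ⊤ := by
    rw [σ.surjective.range_comp]
    exact (fourierBasis b).dense_span
  have hcoe : ∀ n, normChar b n ∘ proj b =
      ((Real.sqrt ((vol b).real Set.univ))⁻¹ : ℂ) • charLift b n := fun n => rfl
  refine ⟨{ freq := fun j => 2 * Real.pi * ‖latticeVector c (σ j)‖
            e := fun j => normChar b (σ j)
            freq_nonneg := fun j => by positivity
            freq_mono := hσ
            smooth := fun j => ?_
            eigen := fun j x => ?_
            basis := HilbertBasis.mk ((fourierBasis b).orthonormal.comp σ σ.injective) hspan.ge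
            basis_ae := fun j => ?_ }⟩
  · unfold IsSmooth
    rw [hcoe]
    exact contDiff_const.smul (hc.contDiff_charLift _)
  · obtain ⟨v, rfl⟩ := proj_surjective b x
    rw [laplaceBeltrami_proj, hcoe, normChar_apply, char_proj,
      InnerProductSpace.laplacian_smul _ ((hc.contDiff_charLift _).contDiffAt.of_le (by norm_cast)),
      hc.laplacian_charLift, smul_eq_mul]
    ring
  · rw [HilbertBasis.coe_mk, Function.comp_apply, fourierBasis_apply]
    exact ContinuousMap.coeFn_toLp (𝕜 := ℂ) (vol b) _

end FlatTorus

/-! ### Linearity of isometries defined on a ball -/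

theorem eq_of_inner_basis_eq {ι E : Type*} [Fintype ι] [NormedAddCommGroup E]
    [InnerProductSpace ℝ E] (e : Module.Basis ι ℝ E) {x y : E}
    (h : ∀ i, ⟪e i, x⟫_ℝ = ⟪e i, y⟫_ℝ) : x = y := by
  refine ext_inner_left ℝ fun v => ?_
  rw [← e.sum_repr v, sum_inner, sum_inner]
  simp_rw [inner_smul_left, h]

/-- A distance and norm preserving map on a ball of a finite-dimensional inner product space is the
restriction of a linear isometry. -/
theorem exists_linearIsometryEquiv_eqOn_ball {E : Type*} [NormedAddCommGroup E]
    [InnerProductSpace ℝ E] [FiniteDimensional ℝ E] {r : ℝ} (hr : 0 < r) {ψ : E → E}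
    (hnorm : ∀ v, ‖v‖ < r → ‖ψ v‖ = ‖v‖)
    (hdist : ∀ v w, ‖v‖ < r → ‖w‖ < r → ‖ψ v - ψ w‖ = ‖v - w‖) :
    ∃ A : E ≃ₗᵢ[ℝ] E, ∀ v, ‖v‖ < r → ψ v = A v := by
  have hinner : ∀ v w, ‖v‖ < r → ‖w‖ < r → ⟪ψ v, ψ w⟫_ℝ = ⟪v, w⟫_ℝ := by
    intro v w hv hw
    rw [real_inner_eq_norm_mul_self_add_norm_mul_self_sub_norm_sub_mul_self_div_two,
      real_inner_eq_norm_mul_self_add_norm_mul_self_sub_norm_sub_mul_self_div_two,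
      hnorm v hv, hnorm w hw, hdist v w hv hw]
  let u := stdOrthonormalBasis ℝ E
  -- The orthonormal basis is shrunk into the ball, where `ψ` preserves inner products; rescaled
  -- images of these vectors determine the linear map.
  have hu : ∀ i, ‖(r / 2) • u i‖ < r := by
    intro i
    rw [norm_smul, u.norm_eq_one, Real.norm_of_nonneg (by positivity)]
    linarith
  have hf : Orthonormal ℝ fun i => (2 / r) • ψ ((r / 2) • u i) := by
    rw [orthonormal_iff_ite]
    intro i j
    rw [inner_smul_left, inner_smul_right, hinner _ _ (hu i) (hu j), inner_smul_left,
      inner_smul_right, orthonormal_iff_ite.1 u.orthonormal i j]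
    simp only [conj_trivial]
    split_ifs
    · field_simp
    · simp
  let f := OrthonormalBasis.mk hf
    (hf.linearIndependent.span_eq_top_of_card_eq_finrank' (by simp)).ge
  have hfi : ∀ i, f i = (2 / r) • ψ ((r / 2) • u i) := fun i => by simp [f]
  refine ⟨u.equiv f (Equiv.refl _), fun v hv => eq_of_inner_basis_eq f.toBasis fun i => ?_⟩
  have h1 : f i = u.equiv f (Equiv.refl _) (u i) := by simp
  rw [OrthonormalBasis.coe_toBasis]
  conv_rhs => rw [h1, LinearIsometryEquiv.inner_map_map]
  rw [hfi, inner_smul_left, hinner _ _ (hu i) hv, inner_smul_left]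
  simp only [conj_trivial]
  field_simp

namespace FlatTorus

variable {d : ℕ} {b b' : Module.Basis (Fin d) ℝ (EuclideanSpace ℝ (Fin d))}

/-! ### Isometries of flat tori -/

/-- The positive number `r` is at most a quarter of the length of any nonzero lattice vector. -/
def IsGap (b : Module.Basis (Fin d) ℝ (EuclideanSpace ℝ (Fin d))) (r : ℝ) : Prop :=
  0 < r ∧ ∀ l ∈ Submodule.span ℤ (Set.range b), ‖l‖ < 4 * r → l = 0

theorem exists_isGap (b : Module.Basis (Fin d) ℝ (EuclideanSpace ℝ (Fin d))) :
    ∃ r, IsGap b r := by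
  have hd : DiscreteTopology
    (Submodule.span ℤ (Set.range b) : Set (EuclideanSpace ℝ (Fin d))) :=
    inferInstanceAs (DiscreteTopology (Submodule.span ℤ (Set.range b)))
  obtain ⟨ε, hε, h⟩ := Metric.exists_ball_inter_eq_singleton_of_mem_discrete
    (isDiscrete_iff_discreteTopology.2 hd) (Submodule.zero_mem (Submodule.span ℤ (Set.range b)))
  refine ⟨ε / 4, by positivity, fun l hl hn => ?_⟩
  have : l ∈ Metric.ball 0 ε ∩ (Submodule.span ℤ (Set.range b) : Set _) :=
    ⟨by simpa using (by linarith : ‖l‖ < ε), hl⟩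
  rw [h] at this
  exact this

theorem IsGap.mono {r s : ℝ} (h : IsGap b r) (hs : 0 < s) (hsr : s ≤ r) : IsGap b s :=
  ⟨hs, fun l hl hn => h.2 l hl (by linarith)⟩

theorem proj_eq_proj_iff {v w : EuclideanSpace ℝ (Fin d)} :
    proj b v = proj b w ↔ v - w ∈ Submodule.span ℤ (Set.range b) := by
  rw [← sub_eq_zero, ← proj_sub, proj_eq_zero_iff]

/-- Any other representative is at distance at least `4r` from `v`, hence longer than `2r`. -/
theorem IsGap.norm_proj {r : ℝ} (h : IsGap b r) {v : EuclideanSpace ℝ (Fin d)}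
    (hv : ‖v‖ < 2 * r) : ‖proj b v‖ = ‖v‖ := by
  apply le_antisymm (QuotientAddGroup.norm_mk_le_norm)
  rw [QuotientAddGroup.le_norm_iff]
  intro m hm
  have hm' := proj_eq_proj_iff.1 (show proj b m = proj b v from hm)
  by_cases hlt : ‖m - v‖ < 4 * r
  · rw [sub_eq_zero.1 (h.2 _ hm' hlt)]
  · have := norm_sub_le m v
    linarith

theorem IsGap.proj_inj {r : ℝ} (h : IsGap b r) {v w : EuclideanSpace ℝ (Fin d)}
    (hv : ‖v‖ < 2 * r) (hw : ‖w‖ < 2 * r) (hvw : proj b v = proj b w) : v = w :=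
  sub_eq_zero.1 (h.2 _ (proj_eq_proj_iff.1 hvw) (by linarith [norm_sub_le v w]))

theorem IsGap.exists_lift {r : ℝ} (h : IsGap b r) {x : FlatTorus b} (hx : ‖x‖ < 2 * r) :
    ∃ v, proj b v = x ∧ ‖v‖ = ‖x‖ := by
  obtain ⟨v, rfl, hv⟩ := QuotientAddGroup.norm_lt_iff.1 hx
  exact ⟨v, rfl, (h.norm_proj hv).symm⟩

/-- The projections preserve distances on the ball of radius `r`, as differences there are shorter
than `2r`. So `φ`, recentred at `x`, lifts to a map of the ball preserving norms and distances. -/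
theorem exists_local_linearIsometryEquiv {r : ℝ} (h : IsGap b r) (h' : IsGap b' r)
    (φ : FlatTorus b ≃ᵢ FlatTorus b') (x : FlatTorus b) :
    ∃ A : EuclideanSpace ℝ (Fin d) ≃ₗᵢ[ℝ] EuclideanSpace ℝ (Fin d),
      ∀ v, ‖v‖ < r → φ (x + proj b v) = φ x + proj b' (A v) := by
  have hr := h.1
  have hlift : ∀ v, ∃ w, ‖v‖ < r → proj b' w = φ (x + proj b v) - φ x ∧ ‖w‖ = ‖v‖ := by
    intro v
    by_cases hv : ‖v‖ < r
    · have hn : ‖φ (x + proj b v) - φ x‖ = ‖v‖ := by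
        rw [← dist_eq_norm, φ.dist_eq, dist_eq_norm, add_sub_cancel_left,
          h.norm_proj (by linarith)]
      obtain ⟨w, hw, hw'⟩ := h'.exists_lift (x := φ (x + proj b v) - φ x) (by rw [hn]; linarith)
      exact ⟨w, fun _ => ⟨hw, hw'.trans hn⟩⟩
    · exact ⟨0, fun h => absurd h hv⟩
  choose ψ hψ using hlift
  obtain ⟨A, hA⟩ := exists_linearIsometryEquiv_eqOn_ball hr (fun v hv => (hψ v hv).2)
    (fun v w hv hw => by
      have h1 := norm_sub_le (ψ v) (ψ w)
      have h2 := norm_sub_le v w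
      rw [(hψ v hv).2, (hψ w hw).2] at h1
      rw [← h'.norm_proj (by linarith), ← h.norm_proj (v := v - w) (by linarith), proj_sub,
        (hψ v hv).1, (hψ w hw).1, sub_sub_sub_cancel_right, ← dist_eq_norm, φ.dist_eq,
        dist_eq_norm, add_sub_add_left_eq_sub, proj_sub])
  refine ⟨A, fun v hv => ?_⟩
  rw [← hA v hv, (hψ v hv).1]
  abel

/-- An isometry of flat tori lifts to an affine isometry of the universal covers. -/
theorem exists_linearIsometryEquiv_lift (φ : FlatTorus b ≃ᵢ FlatTorus b') :
    ∃ A : EuclideanSpace ℝ (Fin d) ≃ₗᵢ[ℝ] EuclideanSpace ℝ (Fin d),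
      ∀ v, φ (proj b v) = φ 0 + proj b' (A v) := by
  obtain ⟨r₁, h₁⟩ := exists_isGap b
  obtain ⟨r₂, h₂⟩ := exists_isGap b'
  have hr : 0 < min r₁ r₂ := lt_min h₁.1 h₂.1
  set r := min r₁ r₂
  have h : IsGap b r := h₁.mono hr (min_le_left _ _)
  have h' : IsGap b' r := h₂.mono hr (min_le_right _ _)
  choose A hA using exists_local_linearIsometryEquiv h h' φ
  -- The linear part is locally constant: the expansions around `x` and `x + proj b w` agree on
  -- small vectors, where `proj b'` is injective.
  have hloc : ∀ x w, ‖w‖ < r / 2 → A (x + proj b w) = A x := by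
    intro x w hw
    have hsmall : ∀ v, ‖v‖ < r / 2 → A (x + proj b w) v = A x v := by
      intro v hv
      have hvw : ‖w + v‖ < r := (norm_add_le _ _).trans_lt (by linarith)
      have e1 := hA x (w + v) hvw
      have e2 := hA (x + proj b w) v (by linarith)
      rw [proj_add, ← add_assoc, e2, hA x w (by linarith), map_add, proj_add, add_assoc] at e1
      exact h'.proj_inj (by rw [LinearIsometryEquiv.norm_map]; linarith)
        (by rw [LinearIsometryEquiv.norm_map]; linarith)
        (add_left_cancel (add_left_cancel e1))
    ext1 v
    have hpos : 0 < r / 2 / (‖v‖ + 1) := by positivity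
    have := hsmall ((r / 2 / (‖v‖ + 1)) • v) (by
      rw [norm_smul, Real.norm_of_nonneg hpos.le, div_mul_eq_mul_div, div_lt_iff₀ (by positivity)]
      nlinarith [norm_nonneg v])
    rw [map_smul, map_smul] at this
    exact smul_right_injective _ hpos.ne' this
  -- Continuation from `0` along a segment in steps shorter than `r / 2`.
  have hiter : ∀ u, ‖u‖ < r / 2 → ∀ k : ℕ, A (proj b ((k : ℝ) • u)) = A 0 ∧
      φ (proj b ((k : ℝ) • u)) = φ 0 + proj b' (A 0 ((k : ℝ) • u)) := by
    intro u hu k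
    induction k with
    | zero =>
      have h0 : proj b 0 = 0 := rfl
      have h0' : proj b' 0 = 0 := rfl
      simp [h0, h0']
    | succ k ih =>
      have e : ((k + 1 : ℕ) : ℝ) • u = (k : ℝ) • u + u := by push_cast; rw [add_smul, one_smul]
      rw [e, proj_add]
      refine ⟨(hloc _ _ hu).trans ih.1, ?_⟩
      rw [hA _ u (by linarith), ih.1, ih.2, map_add, proj_add, add_assoc]
  refine ⟨A 0, fun v => ?_⟩
  obtain ⟨N, hN⟩ := exists_nat_gt (‖v‖ / (r / 2))
  have hN0 : (0 : ℝ) < N := lt_of_le_of_lt (by positivity) hN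
  have := (hiter ((N : ℝ)⁻¹ • v) (by
    rw [norm_smul, Real.norm_of_nonneg (by positivity), inv_mul_lt_iff₀ hN0]
    rwa [div_lt_iff₀ (by positivity)] at hN) N).2
  rwa [smul_smul, mul_inv_cancel₀ hN0.ne', one_smul] at this

variable {c c' : Fin d → EuclideanSpace ℝ (Fin d)}

theorem IsDual.eq_latticeVector (hc : IsDual b c) {v : EuclideanSpace ℝ (Fin d)} {n : Fin d → ℤ}
    (h : ∀ i, ⟪v, b i⟫_ℝ = n i) : v = latticeVector c n := by
  refine eq_of_inner_basis_eq b fun i => ?_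
  rw [real_inner_comm, h, real_inner_comm, hc.inner_latticeVector]
  simp [Finsupp.single_apply]

/-- Isometric flat tori have isometric dual lattices. -/
theorem IsDual.exists_linearIsometryEquiv (hc : IsDual b c) (hc' : IsDual b' c')
    (φ : FlatTorus b ≃ᵢ FlatTorus b') :
    ∃ B : EuclideanSpace ℝ (Fin d) ≃ₗᵢ[ℝ] EuclideanSpace ℝ (Fin d),
      ∀ n', ∃ n, B (latticeVector c' n') = latticeVector c n := by
  obtain ⟨A, hA⟩ := exists_linearIsometryEquiv_lift φ
  refine ⟨A.symm, fun n' => ?_⟩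
  have key : ∀ i, ∃ k : ℤ, ⟪A.symm (latticeVector c' n'), b i⟫_ℝ = k := by
    intro i
    have hmem : b i ∈ Submodule.span ℤ (Set.range b) := Submodule.subset_span ⟨i, rfl⟩
    -- As `b i` projects to `0`, its image `A (b i)` lies in the target lattice and pairs integrally
    -- with dual vectors.
    have h1 := hA (b i)
    rw [(proj_eq_zero_iff b).2 hmem, left_eq_add, proj_eq_zero_iff,
      b'.mem_span_iff_repr_mem ℤ] at h1
    choose k hk using h1
    refine ⟨∑ j, n' j * k j, ?_⟩
    rw [← LinearIsometryEquiv.inner_map_map A, LinearIsometryEquiv.apply_symm_apply,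
      hc'.inner_latticeVector]
    simp [← hk]
  choose n hn using key
  exact ⟨n, hc.eq_latticeVector hn⟩

end FlatTorus

/-! ### Arithmetic of the Conway-Sloane lattices -/

/-- The rows of the Conway-Sloane lattice of positive sign. -/
def conwaySloanePos : Matrix (Fin 4) (Fin 4) ℤ :=
  !![3, -1, -1, -1; 1, 3, -1, 1; 1, 1, 3, -1; 1, -1, 1, 3]

/-- The rows of the Conway-Sloane lattice of negative sign. -/
def conwaySloaneNeg : Matrix (Fin 4) (Fin 4) ℤ :=
  !![-3, -1, -1, -1; 1, -3, -1, 1; 1, 1, -3, -1; 1, -1, 1, -3]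

theorem det_conwaySloanePos : conwaySloanePos.det = 144 := by decide +kernel

theorem det_conwaySloaneNeg : conwaySloaneNeg.det = 144 := by decide +kernel

theorem vecMul_conwaySloanePos (n : Fin 4 → ℤ) : Matrix.vecMul n conwaySloanePos =
    ![3 * n 0 + n 1 + n 2 + n 3, -n 0 + 3 * n 1 + n 2 - n 3, -n 0 - n 1 + 3 * n 2 + n 3,
      -n 0 + n 1 - n 2 + 3 * n 3] := by
  ext i
  fin_cases i <;> simp [conwaySloanePos, Matrix.vecMul, dotProduct, Fin.sum_univ_four] <;> ring

theorem vecMul_conwaySloaneNeg (n : Fin 4 → ℤ) : Matrix.vecMul n conwaySloaneNeg =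
    ![-3 * n 0 + n 1 + n 2 + n 3, -n 0 - 3 * n 1 + n 2 - n 3, -n 0 - n 1 - 3 * n 2 + n 3,
      -n 0 + n 1 - n 2 - 3 * n 3] := by
  ext i
  fin_cases i <;> simp [conwaySloaneNeg, Matrix.vecMul, dotProduct, Fin.sum_univ_four] <;> ring

/-- Change the sign of the first coordinate divisible by three, unless the vector is even. -/
def signFlip (v : Fin 4 → ℤ) : Fin 4 → ℤ :=
  if 2 ∣ v 0 then v
  else if 3 ∣ v 0 then ![-v 0, v 1, v 2, v 3]
  else if 3 ∣ v 1 then ![v 0, -v 1, v 2, v 3]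
  else if 3 ∣ v 2 then ![v 0, v 1, -v 2, v 3]
  else ![v 0, v 1, v 2, -v 3]

theorem signFlip_sq (v : Fin 4 → ℤ) (i : Fin 4) : signFlip v i ^ 2 = v i ^ 2 := by
  unfold signFlip
  split_ifs <;> fin_cases i <;> simp

/-- Divisibility ignores signs, so both applications take the same branch. -/
theorem signFlip_signFlip (v : Fin 4 → ℤ) : signFlip (signFlip v) = v := by
  have hv : v = ![v 0, v 1, v 2, v 3] := by ext i; fin_cases i <;> rfl
  by_cases h : 2 ∣ v 0
  · simp [signFlip, h]
  by_cases h0 : 3 ∣ v 0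
  · conv_rhs => rw [hv]
    simp [signFlip, h, h0]
  by_cases h1 : 3 ∣ v 1
  · conv_rhs => rw [hv]
    simp [signFlip, h, h0, h1]
  by_cases h2 : 3 ∣ v 2
  · conv_rhs => rw [hv]
    simp [signFlip, h, h0, h1, h2]
  · conv_rhs => rw [hv]
    simp [signFlip, h, h0, h1, h2]

/-- Modulo 3 both lattices reduce to the tetracode, in which every word has a zero coordinate. -/
theorem three_dvd_of_tetracode {x y z w : ℤ} (hz : 3 ∣ z - (y - x)) (hw : 3 ∣ w - (x + y))
    (h0 : ¬3 ∣ x) (h1 : ¬3 ∣ y) (h2 : ¬3 ∣ z) : 3 ∣ w := by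
  have hx : x % 3 = 1 ∨ x % 3 = 2 := by omega
  have hy : y % 3 = 1 ∨ y % 3 = 2 := by omega
  rcases hx with hx | hx <;> rcases hy with hy | hy <;> omega

/-- Each matrix `N` satisfies `N Nᵀ = 12`, so a vector lies in the row lattice iff its products with
all rows are divisible by 12. Within a lattice vector all coordinates have the same parity. Passing
from `3` to `-3` changes the products by `6 vᵢ`, which is harmless for even vectors. For odd ones it
is a change by 2 modulo 4, cancelled by reversing one odd coordinate; if that coordinate is
divisible by 3, nothing changes modulo 3. -/
theorem exists_vecMul_conwaySloaneNeg (n : Fin 4 → ℤ) :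
    ∃ m, Matrix.vecMul m conwaySloaneNeg = signFlip (Matrix.vecMul n conwaySloanePos) := by
  rw [vecMul_conwaySloanePos]
  have htet := three_dvd_of_tetracode (x := 3 * n 0 + n 1 + n 2 + n 3)
    (y := -n 0 + 3 * n 1 + n 2 - n 3) (z := -n 0 - n 1 + 3 * n 2 + n 3)
    (w := -n 0 + n 1 - n 2 + 3 * n 3) (by omega) (by omega)
  have key : ∀ v : Fin 4 → ℤ, 12 ∣ -3 * v 0 - v 1 - v 2 - v 3 → 12 ∣ v 0 - 3 * v 1 - v 2 + v 3 →
      12 ∣ v 0 + v 1 - 3 * v 2 - v 3 → 12 ∣ v 0 - v 1 + v 2 - 3 * v 3 →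
      ∃ m, Matrix.vecMul m conwaySloaneNeg = v := by
    rintro v ⟨a, ha⟩ ⟨b, hb⟩ ⟨c, hc⟩ ⟨d, hd⟩
    refine ⟨![a, b, c, d], ?_⟩
    rw [vecMul_conwaySloaneNeg]
    ext i
    fin_cases i <;> simp <;> omega
  -- Only the last branch of `signFlip` needs the tetracode, to know that `3` divides the last
  -- coordinate.
  apply key <;> clear key <;> unfold signFlip <;> split_ifs with h h0 h1 h2 <;>
    simp only [Fin.isValue, Matrix.cons_val] at * <;>
    first
    | (clear htet; omega)
    | (have := htet h0 h1 h2; omega)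

theorem exists_vecMul_conwaySloanePos (n : Fin 4 → ℤ) :
    ∃ m, Matrix.vecMul m conwaySloanePos = signFlip (Matrix.vecMul n conwaySloaneNeg) := by
  rw [vecMul_conwaySloaneNeg]
  have htet := three_dvd_of_tetracode (x := -3 * n 0 + n 1 + n 2 + n 3)
    (y := -n 0 - 3 * n 1 + n 2 - n 3) (z := -n 0 - n 1 - 3 * n 2 + n 3)
    (w := -n 0 + n 1 - n 2 - 3 * n 3) (by omega) (by omega)
  have key : ∀ v : Fin 4 → ℤ, 12 ∣ 3 * v 0 - v 1 - v 2 - v 3 → 12 ∣ v 0 + 3 * v 1 - v 2 + v 3 →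
      12 ∣ v 0 + v 1 + 3 * v 2 - v 3 → 12 ∣ v 0 - v 1 + v 2 + 3 * v 3 →
      ∃ m, Matrix.vecMul m conwaySloanePos = v := by
    rintro v ⟨a, ha⟩ ⟨b, hb⟩ ⟨c, hc⟩ ⟨d, hd⟩
    refine ⟨![a, b, c, d], ?_⟩
    rw [vecMul_conwaySloanePos]
    ext i
    fin_cases i <;> simp <;> omega
  apply key <;> clear key <;> unfold signFlip <;> split_ifs with h h0 h1 h2 <;>
    simp only [Fin.isValue, Matrix.cons_val] at * <;>
    first
    | (clear htet; omega)
    | (have := htet h0 h1 h2; omega)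

theorem short_vectors_eighteen {v0 v1 v2 v3 : ℤ}
    (h : v0 ^ 2 + 2 * v1 ^ 2 + 3 * v2 ^ 2 + 4 * v3 ^ 2 = 18)
    (h0 : 12 ∣ -3 * v0 - v1 - v2 - v3) (h1 : 12 ∣ v0 - 3 * v1 - v2 + v3)
    (h2 : 12 ∣ v0 + v1 - 3 * v2 - v3) :
    (v0 = 3 ∧ v1 = 1 ∧ v2 = 1 ∧ v3 = 1) ∨ (v0 = -3 ∧ v1 = -1 ∧ v2 = -1 ∧ v3 = -1) := by
  have b0 : v0 ∈ Finset.Icc (-4 : ℤ) 4 := by rw [Finset.mem_Icc]; constructor <;> nlinarith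
  have b1 : v1 ∈ Finset.Icc (-3 : ℤ) 3 := by rw [Finset.mem_Icc]; constructor <;> nlinarith
  have b2 : v2 ∈ Finset.Icc (-2 : ℤ) 2 := by rw [Finset.mem_Icc]; constructor <;> nlinarith
  have b3 : v3 ∈ Finset.Icc (-2 : ℤ) 2 := by rw [Finset.mem_Icc]; constructor <;> nlinarith
  have : ∀ v0 ∈ Finset.Icc (-4 : ℤ) 4, ∀ v1 ∈ Finset.Icc (-3 : ℤ) 3, ∀ v2 ∈ Finset.Icc (-2 : ℤ) 2,
      ∀ v3 ∈ Finset.Icc (-2 : ℤ) 2, v0 ^ 2 + 2 * v1 ^ 2 + 3 * v2 ^ 2 + 4 * v3 ^ 2 = 18 →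
      12 ∣ -3 * v0 - v1 - v2 - v3 → 12 ∣ v0 - 3 * v1 - v2 + v3 → 12 ∣ v0 + v1 - 3 * v2 - v3 →
      (v0 = 3 ∧ v1 = 1 ∧ v2 = 1 ∧ v3 = 1) ∨ (v0 = -3 ∧ v1 = -1 ∧ v2 = -1 ∧ v3 = -1) := by
    decide +kernel
  exact this v0 b0 v1 b1 v2 b2 v3 b3 h h0 h1 h2

theorem short_vectors_twentySix {v0 v1 v2 v3 : ℤ}
    (h : v0 ^ 2 + 2 * v1 ^ 2 + 3 * v2 ^ 2 + 4 * v3 ^ 2 = 26)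
    (h0 : 12 ∣ -3 * v0 - v1 - v2 - v3) (h1 : 12 ∣ v0 - 3 * v1 - v2 + v3)
    (h2 : 12 ∣ v0 + v1 - 3 * v2 - v3) :
    (v0 = 1 ∧ v1 = -3 ∧ v2 = -1 ∧ v3 = 1) ∨ (v0 = -1 ∧ v1 = 3 ∧ v2 = 1 ∧ v3 = -1) := by
  have b0 : v0 ∈ Finset.Icc (-5 : ℤ) 5 := by rw [Finset.mem_Icc]; constructor <;> nlinarith
  have b1 : v1 ∈ Finset.Icc (-3 : ℤ) 3 := by rw [Finset.mem_Icc]; constructor <;> nlinarith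
  have b2 : v2 ∈ Finset.Icc (-2 : ℤ) 2 := by rw [Finset.mem_Icc]; constructor <;> nlinarith
  have b3 : v3 ∈ Finset.Icc (-2 : ℤ) 2 := by rw [Finset.mem_Icc]; constructor <;> nlinarith
  have : ∀ v0 ∈ Finset.Icc (-5 : ℤ) 5, ∀ v1 ∈ Finset.Icc (-3 : ℤ) 3, ∀ v2 ∈ Finset.Icc (-2 : ℤ) 2,
      ∀ v3 ∈ Finset.Icc (-2 : ℤ) 2, v0 ^ 2 + 2 * v1 ^ 2 + 3 * v2 ^ 2 + 4 * v3 ^ 2 = 26 →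
      12 ∣ -3 * v0 - v1 - v2 - v3 → 12 ∣ v0 - 3 * v1 - v2 + v3 → 12 ∣ v0 + v1 - 3 * v2 - v3 →
      (v0 = 1 ∧ v1 = -3 ∧ v2 = -1 ∧ v3 = 1) ∨ (v0 = -1 ∧ v1 = 3 ∧ v2 = 1 ∧ v3 = -1) := by
    decide +kernel
  exact this v0 b0 v1 b1 v2 b2 v3 b3 h h0 h1 h2

/-- The Gram matrix of the first two rows of the positive lattice, for the weights `1, 2, 3, 4`, is
not represented by the negative lattice. -/
theorem conwaySloaneNeg_not_represents {m n : Fin 4 → ℤ} {v w : Fin 4 → ℤ}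
    (hv : Matrix.vecMul m conwaySloaneNeg = v) (hw : Matrix.vecMul n conwaySloaneNeg = w)
    (h18 : v 0 ^ 2 + 2 * v 1 ^ 2 + 3 * v 2 ^ 2 + 4 * v 3 ^ 2 = 18)
    (h26 : w 0 ^ 2 + 2 * w 1 ^ 2 + 3 * w 2 ^ 2 + 4 * w 3 ^ 2 = 26) :
    v 0 * w 0 + 2 * (v 1 * w 1) + 3 * (v 2 * w 2) + 4 * (v 3 * w 3) ≠ -4 := by
  have hdvd : ∀ (m v : Fin 4 → ℤ), Matrix.vecMul m conwaySloaneNeg = v →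
      12 ∣ -3 * v 0 - v 1 - v 2 - v 3 ∧ 12 ∣ v 0 - 3 * v 1 - v 2 + v 3 ∧
      12 ∣ v 0 + v 1 - 3 * v 2 - v 3 := by
    rintro m v rfl
    rw [vecMul_conwaySloaneNeg]
    simp only [Fin.isValue, Matrix.cons_val]
    omega
  obtain ⟨hv0, hv1, hv2⟩ := hdvd m v hv
  obtain ⟨hw0, hw1, hw2⟩ := hdvd n w hw
  -- The possible inner products are `±2`.
  rcases short_vectors_eighteen h18 hv0 hv1 hv2 with ⟨e0, e1, e2, e3⟩ | ⟨e0, e1, e2, e3⟩ <;>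
  rcases short_vectors_twentySix h26 hw0 hw1 hw2 with ⟨f0, f1, f2, f3⟩ | ⟨f0, f1, f2, f3⟩ <;>
  rw [e0, e1, e2, e3, f0, f1, f2, f3] <;> decide

/-! ### Lattices from weighted integer matrices -/

namespace FlatTorus

variable {d : ℕ}

/-- Every matrix of nonzero determinant has a dual basis, whose torus has volume inversely
proportional to the determinant. -/
theorem exists_isDual (C : Matrix (Fin d) (Fin d) ℝ) (hC : C.det ≠ 0) :
    ∃ b : Module.Basis (Fin d) ℝ (EuclideanSpace ℝ (Fin d)),
      IsDual b (fun i => WithLp.toLp 2 (C i)) ∧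
      (vol b).real Set.univ = |C.det|⁻¹ *
        volume.real (ZSpan.fundamentalDomain (EuclideanSpace.basisFun (Fin d) ℝ).toBasis) := by
  have hu : IsUnit C.det := hC.isUnit
  set b₀ := (EuclideanSpace.basisFun (Fin d) ℝ).toBasis with hb₀
  have hA : IsUnit (C⁻¹).det := Matrix.isUnit_nonsing_inv_det C hu
  -- The columns of `C⁻¹`: duality to the rows of `C` is `C * C⁻¹ = 1`.
  let b := b₀.map (Matrix.toLinearEquiv b₀ C⁻¹ hA)
  have hb : ∀ j, b j = WithLp.toLp 2 (fun k => C⁻¹ k j) := by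
    intro j
    have h1 : b j = Matrix.toLin b₀ b₀ C⁻¹ (b₀ j) := rfl
    rw [h1, Matrix.toLin_self]
    ext k
    simp [hb₀, Finset.sum_apply, Pi.single_apply]
  refine ⟨b, fun i j => ?_, ?_⟩
  · rw [hb, EuclideanSpace.inner_toLp_toLp, dotProduct_comm]
    have h := congrFun (congrFun (Matrix.mul_nonsing_inv C hu) i) j
    rw [Matrix.mul_apply, Matrix.one_apply] at h
    simpa [dotProduct] using h
  · rw [measureReal_def, vol_univ, ← measureReal_def,
      ZSpan.measureReal_fundamentalDomain b volume b₀]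
    congr 1
    have : b₀.toMatrix b = C⁻¹ := by
      ext i j
      rw [Module.Basis.toMatrix_apply, hb]
      simp [hb₀]
    rw [Module.Basis.det_apply, this, Matrix.det_nonsing_inv, Ring.inverse_eq_inv', abs_inv]

section Weighted

variable {ι : Type*} [Fintype ι] [DecidableEq ι]

/-- The real matrix whose rows, with the Euclidean inner product, span the integral lattice of the
rows of `N` with the inner product of weights `a`. -/
noncomputable def weightedMatrix (σ : Fin d ≃ ι) (a : ι → ℝ) (N : Matrix ι ι ℤ) :
    Matrix (Fin d) (Fin d) ℝ :=
  (N.map (Int.cast : ℤ → ℝ) * Matrix.diagonal fun i => Real.sqrt (a i)).submatrix σ σ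

theorem det_weightedMatrix (σ : Fin d ≃ ι) (a : ι → ℝ) (N : Matrix ι ι ℤ) :
    (weightedMatrix σ a N).det = N.det * ∏ i, Real.sqrt (a i) := by
  rw [weightedMatrix, Matrix.det_submatrix_equiv_self, Matrix.det_mul, Matrix.det_diagonal,
    Int.cast_det]

theorem latticeVector_weightedMatrix (σ : Fin d ≃ ι) (a : ι → ℝ) (N : Matrix ι ι ℤ)
    (n : Fin d → ℤ) (j : Fin d) :
    latticeVector (fun i => WithLp.toLp 2 (weightedMatrix σ a N i)) n j =
      Real.sqrt (a (σ j)) * (Matrix.vecMul (n ∘ σ.symm) N (σ j) : ℤ) := by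
  have h := Equiv.sum_comp σ fun i => (n (σ.symm i) : ℝ) * (N i (σ j) * Real.sqrt (a (σ j)))
  simp only [Equiv.symm_apply_apply] at h
  simp only [latticeVector, weightedMatrix, WithLp.ofLp_sum, WithLp.ofLp_smul, Finset.sum_apply,
    Pi.smul_apply, smul_eq_mul, Matrix.submatrix_apply, Matrix.mul_diagonal, Matrix.map_apply]
  rw [h, Matrix.vecMul, dotProduct, Int.cast_sum, Finset.mul_sum]
  refine Finset.sum_congr rfl fun i _ => ?_
  push_cast [Function.comp_apply]
  ring

theorem inner_latticeVector_weightedMatrix (σ : Fin d ≃ ι) {a : ι → ℝ} (ha : ∀ i, 0 < a i)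
    (N : Matrix ι ι ℤ) (m n : Fin d → ℤ) :
    ⟪latticeVector (fun i => WithLp.toLp 2 (weightedMatrix σ a N i)) m,
      latticeVector (fun i => WithLp.toLp 2 (weightedMatrix σ a N i)) n⟫_ℝ =
      ∑ i, a i * ((Matrix.vecMul (m ∘ σ.symm) N i : ℤ) * (Matrix.vecMul (n ∘ σ.symm) N i : ℤ)) := by
  rw [PiLp.inner_apply, ← Equiv.sum_comp σ]
  refine Finset.sum_congr rfl fun j _ => ?_
  rw [latticeVector_weightedMatrix, latticeVector_weightedMatrix]
  have := Real.mul_self_sqrt (ha (σ j)).le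
  simp only [RCLike.inner_apply, conj_trivial]
  linear_combination ((Matrix.vecMul (m ∘ σ.symm) N (σ j) : ℤ) : ℝ) *
    ((Matrix.vecMul (n ∘ σ.symm) N (σ j) : ℤ) : ℝ) * this

theorem norm_latticeVector_eq (σ : Fin d ≃ ι) {a : ι → ℝ} (ha : ∀ i, 0 < a i)
    {N N' : Matrix ι ι ℤ} {m n : Fin d → ℤ}
    (h : ∀ i, Matrix.vecMul (m ∘ σ.symm) N i ^ 2 = Matrix.vecMul (n ∘ σ.symm) N' i ^ 2) :
    ‖latticeVector (fun i => WithLp.toLp 2 (weightedMatrix σ a N i)) m‖ =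
      ‖latticeVector (fun i => WithLp.toLp 2 (weightedMatrix σ a N' i)) n‖ := by
  rw [← sq_eq_sq₀ (norm_nonneg _) (norm_nonneg _), ← real_inner_self_eq_norm_sq,
    ← real_inner_self_eq_norm_sq, inner_latticeVector_weightedMatrix σ ha,
    inner_latticeVector_weightedMatrix σ ha]
  refine Finset.sum_congr rfl fun i _ => ?_
  rw [← sq, ← sq]
  exact_mod_cast congrArg (fun z : ℤ => a i * (z : ℝ)) (h i)

/-- Norms are weighted sums of squared coordinates, which `F` preserves. Nonzero determinants make
coefficients unique, so the chosen maps between coefficient vectors are mutually inverse. -/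
theorem ncard_norm_latticeVector_eq (σ : Fin d ≃ ι) {a : ι → ℝ} (ha : ∀ i, 0 < a i)
    {N N' : Matrix ι ι ℤ} (hN : N.det ≠ 0) (hN' : N'.det ≠ 0) {F : (ι → ℤ) → ι → ℤ}
    (hF : Function.Involutive F) (hsq : ∀ v i, F v i ^ 2 = v i ^ 2)
    (h : ∀ n, ∃ m, Matrix.vecMul m N' = F (Matrix.vecMul n N))
    (h' : ∀ n, ∃ m, Matrix.vecMul m N = F (Matrix.vecMul n N')) (t : ℝ) :
    {n | 2 * Real.pi * ‖latticeVector (fun i => WithLp.toLp 2 (weightedMatrix σ a N i)) n‖ ≤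
      t}.ncard =
    {n | 2 * Real.pi * ‖latticeVector (fun i => WithLp.toLp 2 (weightedMatrix σ a N' i)) n‖ ≤
      t}.ncard := by
  choose f hf using h
  choose g hg using h'
  have hinv : ∀ {M M' : Matrix ι ι ℤ} {f g : (ι → ℤ) → ι → ℤ}, M.det ≠ 0 →
      (∀ n, Matrix.vecMul (f n) M' = F (Matrix.vecMul n M)) →
      (∀ n, Matrix.vecMul (g n) M = F (Matrix.vecMul n M')) → ∀ n, g (f n) = n := by
    intro M M' f g hM hf hg n
    rw [← sub_eq_zero]
    apply Matrix.eq_zero_of_vecMul_eq_zero hM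
    rw [Matrix.sub_vecMul, hg, hf, hF, sub_self]
  let e : (Fin d → ℤ) ≃ (Fin d → ℤ) :=
    { toFun := fun n => f (n ∘ σ.symm) ∘ σ
      invFun := fun n => g (n ∘ σ.symm) ∘ σ
      left_inv := fun n => by simp [Function.comp_assoc, hinv hN hf hg]
      right_inv := fun n => by simp [Function.comp_assoc, hinv hN' hg hf] }
  have he : ∀ n, ‖latticeVector (fun i => WithLp.toLp 2 (weightedMatrix σ a N' i)) (e n)‖ =
      ‖latticeVector (fun i => WithLp.toLp 2 (weightedMatrix σ a N i)) n‖ := by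
    intro n
    apply norm_latticeVector_eq σ ha
    intro i
    have : e n ∘ σ.symm = f (n ∘ σ.symm) := by
      ext i; simp [e]
    rw [this, hf, hsq]
  rw [← Set.ncard_image_of_injective _ e.injective]
  congr 1
  ext n
  rw [Equiv.image_eq_preimage_symm]
  simp only [Set.mem_preimage, Set.mem_ofPred_eq]
  rw [← he, e.apply_symm_apply]

end Weighted

/-! ### The Conway-Sloane pair in dimension `4 + k` -/

section ConwaySloane

variable {k : ℕ}

/-- The weights of the coordinates: `1, 2, 3, 4` on the Conway-Sloane block, `30` elsewhere. -/
def conwaySloaneWeight (k : ℕ) : Fin 4 ⊕ Fin k → ℝ := Sum.elim ![1, 2, 3, 4] fun _ => 30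

theorem conwaySloaneWeight_pos (i : Fin 4 ⊕ Fin k) : 0 < conwaySloaneWeight k i := by
  rcases i with i | i
  · fin_cases i <;> simp [conwaySloaneWeight]
  · simp [conwaySloaneWeight]

/-- The orthogonal sum of a four-dimensional lattice with `ℤᵏ`. -/
def extendByOne (k : ℕ) (M : Matrix (Fin 4) (Fin 4) ℤ) : Matrix (Fin 4 ⊕ Fin k) (Fin 4 ⊕ Fin k) ℤ :=
  Matrix.fromBlocks M 0 0 1

theorem det_extendByOne (M : Matrix (Fin 4) (Fin 4) ℤ) : (extendByOne k M).det = M.det := by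
  simp [extendByOne]

theorem vecMul_extendByOne (M : Matrix (Fin 4) (Fin 4) ℤ) (n : Fin 4 ⊕ Fin k → ℤ) :
    Matrix.vecMul n (extendByOne k M) =
      Sum.elim (Matrix.vecMul (n ∘ Sum.inl) M) (n ∘ Sum.inr) := by
  simp [extendByOne, Matrix.vecMul_fromBlocks]

/-- The sign change of the Conway-Sloane block. -/
def extendedSignFlip (v : Fin 4 ⊕ Fin k → ℤ) : Fin 4 ⊕ Fin k → ℤ :=
  Sum.elim (signFlip (v ∘ Sum.inl)) (v ∘ Sum.inr)

theorem extendedSignFlip_involutive :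
    Function.Involutive (extendedSignFlip : (Fin 4 ⊕ Fin k → ℤ) → _) := by
  intro v
  ext i
  rcases i with i | i
  · simp [extendedSignFlip, signFlip_signFlip]
  · simp [extendedSignFlip]

theorem extendedSignFlip_sq (v : Fin 4 ⊕ Fin k → ℤ) (i : Fin 4 ⊕ Fin k) :
    extendedSignFlip v i ^ 2 = v i ^ 2 := by
  rcases i with i | i
  · simp [extendedSignFlip, signFlip_sq]
  · simp [extendedSignFlip]

theorem exists_vecMul_extendByOne {M M' : Matrix (Fin 4) (Fin 4) ℤ}
    (h : ∀ n, ∃ m, Matrix.vecMul m M' = signFlip (Matrix.vecMul n M)) (n : Fin 4 ⊕ Fin k → ℤ) :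
    ∃ m, Matrix.vecMul m (extendByOne k M') =
      extendedSignFlip (Matrix.vecMul n (extendByOne k M)) := by
  obtain ⟨m, hm⟩ := h (n ∘ Sum.inl)
  refine ⟨Sum.elim m (n ∘ Sum.inr), ?_⟩
  rw [vecMul_extendByOne, vecMul_extendByOne, Sum.elim_comp_inl, hm]
  simp [extendedSignFlip]

theorem sum_conwaySloaneWeight (v w : Fin 4 ⊕ Fin k → ℤ) :
    ∑ i, conwaySloaneWeight k i * ((v i : ℝ) * (w i : ℝ)) =
      ((v (.inl 0) * w (.inl 0) + 2 * (v (.inl 1) * w (.inl 1)) + 3 * (v (.inl 2) * w (.inl 2)) +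
        4 * (v (.inl 3) * w (.inl 3)) + 30 * ∑ s, v (.inr s) * w (.inr s) : ℤ) : ℝ) := by
  rw [Fintype.sum_sum_type, Fin.sum_univ_four]
  push_cast
  simp [conwaySloaneWeight, Finset.mul_sum]

/-- The two lattices are not isometric. -/
theorem conwaySloane_not_isometric (σ : Fin d ≃ Fin 4 ⊕ Fin k)
    (B : EuclideanSpace ℝ (Fin d) ≃ₗᵢ[ℝ] EuclideanSpace ℝ (Fin d))
    (hB : ∀ n', ∃ n, B (latticeVector (fun i => WithLp.toLp 2 (weightedMatrix σ
      (conwaySloaneWeight k) (extendByOne k conwaySloanePos) i)) n') =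
      latticeVector (fun i => WithLp.toLp 2 (weightedMatrix σ
      (conwaySloaneWeight k) (extendByOne k conwaySloaneNeg) i)) n) : False := by
  have hgram : ∀ (m' n' m n : Fin d → ℤ), _ → _ → _ := fun m' n' m n hm hn =>
    (inner_latticeVector_weightedMatrix σ conwaySloaneWeight_pos (extendByOne k conwaySloaneNeg)
      m n).symm.trans ((congrArg₂ (fun x y => ⟪x, y⟫_ℝ) hm hn).symm.trans
      ((B.inner_map_map _ _).trans (inner_latticeVector_weightedMatrix σ conwaySloaneWeight_pos
        (extendByOne k conwaySloanePos) m' n')))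
  -- The first two rows of the positive lattice, of squared norms 18 and 26 and inner product -4.
  obtain ⟨m, hm⟩ := hB (Sum.elim (Pi.single 0 1) 0 ∘ σ)
  obtain ⟨n, hn⟩ := hB (Sum.elim (Pi.single 1 1) 0 ∘ σ)
  have h1 := hgram _ _ m m hm hm
  have h2 := hgram _ _ n n hn hn
  have h3 := hgram _ _ m n hm hn
  simp only [Function.comp_assoc, Equiv.self_comp_symm, Function.comp_id] at h1 h2 h3
  simp only [sum_conwaySloaneWeight, Int.cast_inj, vecMul_extendByOne, Sum.elim_comp_inl,
    Sum.elim_inl, Sum.elim_inr, Sum.elim_comp_inr] at h1 h2 h3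
  set v := Matrix.vecMul ((m ∘ σ.symm) ∘ Sum.inl) conwaySloaneNeg with hv
  set w := Matrix.vecMul ((n ∘ σ.symm) ∘ Sum.inl) conwaySloaneNeg with hw
  set p := (m ∘ σ.symm) ∘ Sum.inr
  set q := (n ∘ σ.symm) ∘ Sum.inr
  simp [conwaySloanePos] at h1 h2 h3
  have hp0 : 0 ≤ ∑ s, p s * p s := Finset.sum_nonneg fun s _ => mul_self_nonneg _
  have hq0 : 0 ≤ ∑ s, q s * q s := Finset.sum_nonneg fun s _ => mul_self_nonneg _
  -- The weight 30 exceeds 18 and 26, so the images have no component in the added summand.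
  have hp : ∑ s, p s * p s = 0 := by
    nlinarith [mul_self_nonneg (v 0), mul_self_nonneg (v 1), mul_self_nonneg (v 2),
      mul_self_nonneg (v 3)]
  have hq : ∑ s, q s * q s = 0 := by
    nlinarith [mul_self_nonneg (w 0), mul_self_nonneg (w 1), mul_self_nonneg (w 2),
      mul_self_nonneg (w 3)]
  have hpq : ∑ s, p s * q s = 0 := Finset.sum_eq_zero fun s hs => by
    have := (Finset.sum_eq_zero_iff_of_nonneg fun s _ => mul_self_nonneg (p s)).1 hp s hs
    rw [mul_self_eq_zero.1 this, zero_mul]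
  refine conwaySloaneNeg_not_represents hv.symm hw.symm ?_ ?_ ?_ <;> linarith

end ConwaySloane

end FlatTorus

/-! ### The two tori -/

/-- `≃ᵢ` are the bijective isometries for the Riemannian distances; in particular an empty type
`FlatTorus b ≃ᵢ FlatTorus b'` excludes every Riemannian isometry. -/
theorem proposition1p2 (d : ℕ) (hd : 4 ≤ d) :
    ∃ b b' : Module.Basis (Fin d) ℝ (EuclideanSpace ℝ (Fin d)),
      IsEmpty (FlatTorus b ≃ᵢ FlatTorus b') ∧
      Nonempty (FlatTorus.EigenSystem b) ∧
      Nonempty (FlatTorus.EigenSystem b') ∧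
      ∃ f : ℝ → ℝ≥0,
        (∀ (S : FlatTorus.EigenSystem b) (x : FlatTorus b) (t : ℝ),
          FlatTorus.localWeyl S x t = (f t : ℝ≥0∞)) ∧
        (∀ (S' : FlatTorus.EigenSystem b') (y : FlatTorus b') (t : ℝ),
          FlatTorus.localWeyl S' y t = (f t : ℝ≥0∞)) := by
  obtain ⟨k, rfl⟩ := Nat.exists_eq_add_of_le hd
  open FlatTorus in
  let σ : Fin (4 + k) ≃ Fin 4 ⊕ Fin k := finSumFinEquiv.symm
  have ha := conwaySloaneWeight_pos (k := k)
  have hprod : ∏ i, Real.sqrt (conwaySloaneWeight k i) ≠ 0 :=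
    Finset.prod_ne_zero_iff.2 fun i _ => (Real.sqrt_pos.2 (ha i)).ne'
  have hdet : (weightedMatrix σ (conwaySloaneWeight k) (extendByOne k conwaySloaneNeg)).det =
      144 * ∏ i, Real.sqrt (conwaySloaneWeight k i) := by
    rw [det_weightedMatrix, det_extendByOne, det_conwaySloaneNeg]; norm_num
  have hdet' : (weightedMatrix σ (conwaySloaneWeight k) (extendByOne k conwaySloanePos)).det =
      144 * ∏ i, Real.sqrt (conwaySloaneWeight k i) := by
    rw [det_weightedMatrix, det_extendByOne, det_conwaySloanePos]; norm_num
  obtain ⟨b, hb, hvol⟩ := exists_isDual _ (hdet ▸ mul_ne_zero (by norm_num) hprod)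
  obtain ⟨b', hb', hvol'⟩ := exists_isDual _ (hdet' ▸ mul_ne_zero (by norm_num) hprod)
  refine ⟨b, b', ⟨fun φ => ?_⟩, hb.nonempty_eigenSystem (by omega),
    hb'.nonempty_eigenSystem (by omega), _, fun S x t => localWeyl_eq hb S x t, fun S y t => ?_⟩
  · obtain ⟨B, hB⟩ := hb.exists_linearIsometryEquiv hb' φ
    exact conwaySloane_not_isometric σ B hB
  -- Equal determinants give equal volumes, and the sign flip gives equal counts.
  · rw [localWeyl_eq hb' S y t, hvol', hdet', ← hdet, ← hvol,
      ncard_norm_latticeVector_eq σ ha (N' := extendByOne k conwaySloaneNeg) (by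
        rw [det_extendByOne, det_conwaySloanePos]; norm_num) (by
        rw [det_extendByOne, det_conwaySloaneNeg]; norm_num) extendedSignFlip_involutive
        extendedSignFlip_sq (exists_vecMul_extendByOne exists_vecMul_conwaySloaneNeg)
        (exists_vecMul_extendByOne exists_vecMul_conwaySloanePos)]
    rfl
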